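/- Let $G$ be a locally finite bipartite graph (multiple edges allowed) embedded in the oriented plane so that every face is a bounded topological disc. Fix a colouring of its vertices in black and white such that every edge joins a black vertex to a white one. The quad-graph of $G$ has the vertices and the faces of $G$ as vertices, one edge for each corner of $G$ (incidence of a vertex and a face), and one quadrilateral face for each edge of $G$. A train-track of $G$ is a maximal path of adjacent quadrilaterals which enters and leaves each quadrilateral through opposite sides, seen as a curve in the plane; train-tracks intersect at edges of $G$. They are oriented consistently, i.e. so that they turn counterclockwise around white vertices and clockwise around black ones. The strands of a train-track are its pieces joining two consecutive edges of $G$; each strand lies in one corner of $G$. The graph $G$ is called minimal if no train-track intersects itself and there is no parallel bigon, i.e. no pair of oriented train-tracks that intersect at two points $x\neq y$ and are both oriented from $x$ to $y$. Suppose that no train-track of $G$ forms a closed loop. Two oriented train-tracks are parallel if either they intersect infinitely many times in the same direction (there are infinitely many intersection points that both traverse in the same order), or they are disjoint and there is a topological disc which they cross in the same direction. They are anti-parallel if the first is parallel to the reverse of the second. For three distinct, pairwise non-parallel train-tracks, take a compact disc $B$ outside of which these train-tracks do not meet, apart from possible anti-parallel ones (for which one only asks that the parts following the outgoing points do not meet);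 the global cyclic order of the three train-tracks is the counterclockwise cyclic order on $\partial B$ of their outgoing points, i.e. the points where they leave $B$ for the last time. It does not depend on $B$, and is a partial cyclic order on the set of train-tracks. For a vertex $v$, let $T(v)$ be the set of strands turning around $v$, with its local cyclic order, the counterclockwise order of their outgoing points around $v$. For a face $f$, let $T^\bullet(f)$ (resp. $T^\circ(f)$) be the set of strands in $f$ turning around a black (resp. white) vertex of $\partial f$, with its local cyclic order, the counterclockwise order of their outgoing points around $f$. The global cyclic order is said to restrict to the local cyclic order on such a set of strands if, for any three of these strands belonging to three distinct train-tracks, the train-tracks are in the global cyclic order if and only if the strands are in the local cyclic order. **Corollary.** Let $G$ be as above, without train-track loops and without vertices of degree $1$. Assume that: 1. for every vertex $v$ of $G$, the strands in $T(v)$ belong to distinct train-tracks, and the global cyclic order restricts to the local cyclic order on $T(v)$; 2. for every face $f$ of $G$, there is a pair of strands in $T^\bullet(f)$ belonging to distinct non-parallel train-tracks, and similarly for $T^\circ(f)$; and the global cyclic order restricts to the local cyclic orders on $T^\bullet(f)$ and on $T^\circ(f)$. Then $G$ is minimal. -/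

import Mathlib

/-- An infinite, connected, locally finite graph (loops and multiple edges allowed) embedded in the
oriented plane so that every face is a bounded topological disc, encoded as a combinatorial map.
`D` is the set of darts (oriented edges): `rev` reverses a dart, and `rot` sends a dart to the next
one counterclockwise around its origin. Vertices are the orbits of `rot`, edges the orbits of `rev`,
and faces the orbits of `rot⁻¹ * rev`, which runs along the boundary of the face lying to the left of
a dart. -/
structure PlaneMap (D : Type*) where
  rev : Equiv.Perm D
  rot : Equiv.Perm D
  rev_rev : ∀ d, rev (rev d) = d
  rev_ne : ∀ d, rev d ≠ d

namespace PlaneMap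

variable {D : Type*} (M : PlaneMap D)

/-- The next dart along the boundary of the face to the left, that face being kept on the left
(so that the boundary of the face is followed counterclockwise). -/
def faceNext : Equiv.Perm D := M.rot⁻¹ * M.rev

/-- The two darts have the same origin. -/
def SameVertex (d e : D) : Prop := M.rot.SameCycle d e

/-- The two darts have the same face on their left. -/
def SameFace (d e : D) : Prop := M.faceNext.SameCycle d e

/-- The vertices of the graph. -/
def Vertex : Type _ := Quotient (Equiv.Perm.SameCycle.setoid M.rot)

/-- The faces of the graph, i.e. the vertices of the dual graph. -/
def Face : Type _ := Quotient (Equiv.Perm.SameCycle.setoid M.faceNext)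

/-- The origin of a dart. -/
def vertexOf (d : D) : M.Vertex := Quotient.mk _ d

/-- The face to the left of a dart. -/
def faceOf (d : D) : M.Face := Quotient.mk _ d

/-- A walk: each dart starts where the preceding one ends. -/
def IsWalk (l : List D) : Prop := l.IsChain (fun d e => M.SameVertex (M.rev d) e)

/-- A closed walk: moreover the last dart ends where the first one starts. -/
def IsClosedWalk (l : List D) : Prop :=
  M.IsWalk l ∧ ∀ a ∈ l.getLast?, ∀ b ∈ l.head?, M.SameVertex (M.rev a) b

/-- The boundary walk of the face to the left of `d`, starting with `d`. -/
noncomputable def faceWalk (d : D) : List D :=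
  (List.range (Function.minimalPeriod M.faceNext d)).map (fun i => (M.faceNext ^ i) d)

/-- Homotopy of walks in the cell complex formed by vertices, edges and faces: it is generated by
inserting or deleting an edge followed by its reverse, or the boundary walk of a face. -/
inductive Homotopic : List D → List D → Prop
  | refl (l : List D) : Homotopic l l
  | symm {l l' : List D} : Homotopic l l' → Homotopic l' l
  | trans {l l' l'' : List D} : Homotopic l l' → Homotopic l' l'' → Homotopic l l''
  | spur (u : List D) (d : D) (w : List D) :
      M.IsWalk (u ++ d :: M.rev d :: w) → Homotopic (u ++ d :: M.rev d :: w) (u ++ w)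
  | face (u : List D) (d : D) (w : List D) :
      M.IsWalk (u ++ (M.faceWalk d ++ w)) → Homotopic (u ++ (M.faceWalk d ++ w)) (u ++ w)

/-- The surface obtained by gluing discs along the face walks is the plane: vertices have finite
degree, faces are bounded (finite degree), and the surface is connected, not compact and simply
connected. -/
structure IsPlanar : Prop where
  infinite : Infinite D
  vertex_finite : ∀ d, {e | M.SameVertex d e}.Finite
  face_finite : ∀ d, {e | M.SameFace d e}.Finite
  connected : ∀ d e, Relation.ReflTransGen (fun a b => b = M.rev a ∨ b = M.rot a) d e
  simplyConnected : ∀ l, M.IsClosedWalk l → M.Homotopic l []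

/-- The cyclic order of the elements of one orbit of a permutation `p`: starting at `x` and
applying `p` repeatedly, one meets `y`, then `z`, before being back at `x` (all three distinct). -/
def OrbitOrder (p : Equiv.Perm D) (x y z : D) : Prop :=
  ∃ i j : ℕ, 0 < i ∧ i < j ∧ j < Function.minimalPeriod p x ∧ (p ^ i) x = y ∧ (p ^ j) x = z

/-- A compact disc in the plane made of quadrilaterals of the quad-graph. The quadrilaterals are the
edges of the graph; the edges of the quad-graph are the corners of the graph, and the corner at the
origin of `d` between `d` and `M.rot d` (in the face to the left of `d`) is denoted by `d`. Its two
adjacent quadrilaterals are the edges of `d` and of `M.rot d`.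

The boundary of the disc is a simple closed walk `bdry 0, bdry 1, …, bdry (2 * len) = bdry 0` in the
quad-graph, followed counterclockwise (with the disc on the left). Corners of even index are followed
from a face to a vertex, and corners of odd index from a vertex to a face. -/
structure Disc where
  /-- the darts of the edges whose quadrilaterals form the disc -/
  quads : Set D
  quads_finite : quads.Finite
  rev_mem : ∀ d, M.rev d ∈ quads ↔ d ∈ quads
  len : ℕ
  len_pos : 0 < len
  bdry : ℕ → D
  bdry_closed : bdry (2 * len) = bdry 0
  vertex_step : ∀ i < len, M.SameVertex (bdry (2 * i)) (bdry (2 * i + 1))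
  face_step : ∀ i < len, M.SameFace (bdry (2 * i + 1)) (bdry (2 * i + 2))
  vertex_simple : ∀ i < len, ∀ j < len, M.SameVertex (bdry (2 * i)) (bdry (2 * j)) → i = j
  face_simple : ∀ i < len, ∀ j < len, M.SameFace (bdry (2 * i + 1)) (bdry (2 * j + 1)) → i = j
  left_even : ∀ i < len, bdry (2 * i) ∈ quads ∧ M.rot (bdry (2 * i)) ∉ quads
  left_odd : ∀ i < len, M.rot (bdry (2 * i + 1)) ∈ quads ∧ bdry (2 * i + 1) ∉ quads
  /-- every corner that separates the disc from its complement is on the boundary walk -/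
  complete : ∀ d, ¬ (d ∈ quads ↔ M.rot d ∈ quads) → ∃ i < 2 * len, bdry i = d

end PlaneMap

/-- A bipartite plane graph: `white d` says whether the origin of the dart `d` is a white vertex (it
is black otherwise), and every edge joins a white vertex to a black one. -/
structure BipartitePlaneGraph (D : Type*) extends PlaneMap D where
  planar : toPlaneMap.IsPlanar
  white : D → Bool
  white_rot : ∀ d, white (rot d) = white d
  white_rev : ∀ d, white (rev d) = !white d

namespace BipartitePlaneGraph

variable {D : Type*} (G : BipartitePlaneGraph D)

/-- Train-track strands, i.e. edges of the graph of train-tracks, correspond to corners of the graph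
and so to darts: the strand `s` turns around the origin of `s`, inside the face to the left of `s`,
and joins the edges of `s` and `rot s`. It is oriented counterclockwise around a white vertex
(from `s` to `rot s`), and clockwise around a black one (from `rot s` to `s`).

`exitEdge s` is the edge at which the strand `s` ends, given by its dart with white origin. -/
def exitEdge (s : D) : D := if G.white s then G.rot s else G.rev s

/-- The strand following a given one on its train-track: the train-track crosses the edge
`exitEdge s` and then turns around the other end-point of this edge, on its other side. -/
def nextStrand : Equiv.Perm D where
  toFun s := if G.white s then G.rot.symm (G.rev (G.rot s)) else G.rev s
  invFun s := if G.white s then G.rev s else G.rot.symm (G.rev (G.rot s))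
  left_inv s := by
    have h (d : D) : G.white (G.rot.symm d) = G.white d := by
      simpa using (G.white_rot (G.rot.symm d)).symm
    cases hs : G.white s <;> simp [hs, h, G.white_rot, G.white_rev, G.rev_rev]
  right_inv s := by
    have h (d : D) : G.white (G.rot.symm d) = G.white d := by
      simpa using (G.white_rot (G.rot.symm d)).symm
    cases hs : G.white s <;> simp [hs, h, G.white_rot, G.white_rev, G.rev_rev]

/-- The two strands belong to the same train-track. The (consistently oriented) train-tracks are the
orbits of `nextStrand`; below, a train-track is given by any of its strands. -/
def SameTrack (s t : D) : Prop := G.nextStrand.SameCycle s t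

/-- No train-track forms a closed loop. -/
def NoTrackLoops : Prop := ∀ s, ∀ n : ℕ, 0 < n → (G.nextStrand ^ n) s ≠ s

/-- No vertex has degree one. -/
def NoDegreeOne : Prop := ∀ d, G.rot d ≠ d

/-- Some train-track intersects itself: it passes twice through the same edge. -/
def HasSelfIntersection : Prop :=
  ∃ s t, s ≠ t ∧ G.SameTrack s t ∧ G.exitEdge s = G.exitEdge t

/-- Some pair of oriented train-tracks intersect at two distinct edges, both being oriented from the
first one to the second one. -/
def HasParallelBigon : Prop :=
  ∃ s t, ¬ G.SameTrack s t ∧ G.exitEdge s = G.exitEdge t ∧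
    ∃ m n : ℕ, 0 < m ∧ 0 < n ∧
      G.exitEdge ((G.nextStrand ^ m) s) = G.exitEdge ((G.nextStrand ^ n) t) ∧
      G.exitEdge ((G.nextStrand ^ m) s) ≠ G.exitEdge s

/-- Minimal bipartite plane graphs. -/
def IsMinimal : Prop := ¬ G.HasSelfIntersection ∧ ¬ G.HasParallelBigon

/-- The train-tracks of `s` and `t` are disjoint. -/
def DisjointTracks (s t : D) : Prop :=
  ∀ m n : ℤ, G.exitEdge ((G.nextStrand ^ m) s) ≠ G.exitEdge ((G.nextStrand ^ n) t)

/-- The vertices of the quad-graph, i.e. the faces of the graph of train-tracks. -/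
abbrev QuadVertex : Type _ := G.Vertex ⊕ G.Face

/-- The face of the graph of train-tracks to the left of an oriented strand. -/
def leftOf (s : D) : G.QuadVertex :=
  if G.white s then Sum.inl (G.vertexOf s) else Sum.inr (G.faceOf s)

/-- The face of the graph of train-tracks to the right of an oriented strand. -/
def rightOf (s : D) : G.QuadVertex :=
  if G.white s then Sum.inr (G.faceOf s) else Sum.inl (G.vertexOf s)

/-- Two faces of the graph of train-tracks are joined by a path in the plane that does not meet the
train-tracks of `s` and `t`. -/
def JoinedAvoiding (s t : D) : G.QuadVertex → G.QuadVertex → Prop :=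
  Relation.EqvGen (fun a b => ∃ u, ¬ G.SameTrack s u ∧ ¬ G.SameTrack t u ∧
    a = G.leftOf u ∧ b = G.rightOf u)

/-- Two oriented train-tracks are parallel if there are infinitely many intersection points that they
meet in the same order, or if they are disjoint and cross a topological disc in the same direction.
Such a disc is a thin neighbourhood of a path joining a strand `x` of the first train-track to a
strand `y` of the second one without meeting them in between; the two are crossed in the same
direction when this path leaves `x` on one side and arrives at `y` on the opposite side. -/
def Parallel (s t : D) : Prop :=
  (∃ C : Set (ℤ × ℤ), C.Infinite ∧
    (∀ c ∈ C, G.exitEdge ((G.nextStrand ^ c.1) s) = G.exitEdge ((G.nextStrand ^ c.2) t)) ∧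
    ∀ c ∈ C, ∀ c' ∈ C, c.1 < c'.1 ↔ c.2 < c'.2) ∨
  (G.DisjointTracks s t ∧ ∃ x y, G.SameTrack s x ∧ G.SameTrack t y ∧
    (G.JoinedAvoiding s t (G.rightOf x) (G.leftOf y) ∨
      G.JoinedAvoiding s t (G.leftOf x) (G.rightOf y)))

/-- Two oriented train-tracks are anti-parallel if the first one is parallel to the reverse of the
second one. -/
def AntiParallel (s t : D) : Prop :=
  (∃ C : Set (ℤ × ℤ), C.Infinite ∧
    (∀ c ∈ C, G.exitEdge ((G.nextStrand ^ c.1) s) = G.exitEdge ((G.nextStrand ^ c.2) t)) ∧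
    ∀ c ∈ C, ∀ c' ∈ C, c.1 < c'.1 ↔ c'.2 < c.2) ∨
  (G.DisjointTracks s t ∧ ∃ x y, G.SameTrack s x ∧ G.SameTrack t y ∧
    (G.JoinedAvoiding s t (G.rightOf x) (G.rightOf y) ∨
      G.JoinedAvoiding s t (G.leftOf x) (G.leftOf y)))

/-- The train-track of `s` leaves the disc `B` for the last time at the boundary point of index `p`,
its outgoing point. -/
def LeavesAt (B : G.Disc) (s : D) (p : ℕ) : Prop :=
  p < 2 * B.len ∧ G.SameTrack s (B.bdry p) ∧
    ∀ n : ℕ, G.exitEdge ((G.nextStrand ^ n) (B.bdry p)) ∉ B.quads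

/-- The train-tracks of `s` and `t`, which leave the disc `B` at the boundary points of index `p` and
`q`, do not meet outside `B`, unless they are anti-parallel; in the latter case, at least
their parts following these points do not meet. -/
def SeparatedOutside (B : G.Disc) (s t : D) (p q : ℕ) : Prop :=
  (¬ G.AntiParallel s t → ∀ m n : ℤ,
    G.exitEdge ((G.nextStrand ^ m) s) = G.exitEdge ((G.nextStrand ^ n) t) →
    G.exitEdge ((G.nextStrand ^ m) s) ∈ B.quads) ∧
  ∀ m n : ℕ,
    G.exitEdge ((G.nextStrand ^ m) (B.bdry p)) ≠ G.exitEdge ((G.nextStrand ^ n) (B.bdry q))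

/-- The global cyclic order on oriented train-tracks. It is defined for three distinct, pairwise
non-parallel train-tracks, as the counterclockwise cyclic order of their outgoing points on the
boundary of a disc outside of which they do not meet, apart from possible anti-parallel ones. -/
def GlobalOrder (s₁ s₂ s₃ : D) : Prop :=
  (¬ G.SameTrack s₁ s₂ ∧ ¬ G.SameTrack s₂ s₃ ∧ ¬ G.SameTrack s₁ s₃) ∧
  (¬ G.Parallel s₁ s₂ ∧ ¬ G.Parallel s₂ s₃ ∧ ¬ G.Parallel s₁ s₃) ∧
  ∃ (B : G.Disc) (p₁ p₂ p₃ : ℕ),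
    G.LeavesAt B s₁ p₁ ∧ G.LeavesAt B s₂ p₂ ∧ G.LeavesAt B s₃ p₃ ∧
    G.SeparatedOutside B s₁ s₂ p₁ p₂ ∧ G.SeparatedOutside B s₂ s₃ p₂ p₃ ∧
    G.SeparatedOutside B s₁ s₃ p₁ p₃ ∧
    ((p₁ < p₂ ∧ p₂ < p₃) ∨ (p₂ < p₃ ∧ p₃ < p₁) ∨ (p₃ < p₁ ∧ p₁ < p₂))

/-- The strands around the vertex at the origin of `d`. -/
def vertexStrands (d : D) : Set D := {s | G.SameVertex d s}

/-- The strands of the face to the left of `d` that turn around black vertices. -/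
def blackFaceStrands (d : D) : Set D := {s | G.SameFace d s ∧ G.white s = false}

/-- The strands of the face to the left of `d` that turn around white vertices. -/
def whiteFaceStrands (d : D) : Set D := {s | G.SameFace d s ∧ G.white s = true}

/-- The global cyclic order on train-tracks restricts to the cyclic order `loc` on the set `S` of
strands: for strands of `S` in distinct train-tracks, both cyclic orders agree. In particular, a
triple of such strands is comparable in the global order as soon as it is in the local one. -/
def RestrictsTo (S : Set D) (loc : D → D → D → Prop) : Prop :=
  ∀ x ∈ S, ∀ y ∈ S, ∀ z ∈ S,
    ¬ G.SameTrack x y → ¬ G.SameTrack y z → ¬ G.SameTrack x z →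
    (G.GlobalOrder x y z ↔ loc x y z)

/-- The strands around any vertex belong to distinct train-tracks, and the global cyclic order
restricts to their local one, i.e. the counterclockwise order around the vertex. -/
def VertexCondition : Prop :=
  ∀ d, (∀ s ∈ G.vertexStrands d, ∀ t ∈ G.vertexStrands d, s ≠ t → ¬ G.SameTrack s t) ∧
    G.RestrictsTo (G.vertexStrands d) (PlaneMap.OrbitOrder G.rot)

/-- For each face and each colour, two of the strands of the face turning around vertices of this
colour belong to distinct non-parallel train-tracks, and the global cyclic order restricts to the
local order of these strands, i.e. the counterclockwise order around the face. -/
def FaceCondition : Prop :=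
  ∀ d,
    (∃ s ∈ G.blackFaceStrands d, ∃ t ∈ G.blackFaceStrands d,
      ¬ G.SameTrack s t ∧ ¬ G.Parallel s t) ∧
    (∃ s ∈ G.whiteFaceStrands d, ∃ t ∈ G.whiteFaceStrands d,
      ¬ G.SameTrack s t ∧ ¬ G.Parallel s t) ∧
    G.RestrictsTo (G.blackFaceStrands d) (PlaneMap.OrbitOrder G.faceNext) ∧
    G.RestrictsTo (G.whiteFaceStrands d) (PlaneMap.OrbitOrder G.faceNext)

end BipartitePlaneGraph

/-! To each edge `e` one attaches an integer function `h e` on the faces of the graph of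
train-tracks, which jumps across the two parts of train-tracks leaving `e`: a discrete version of
the angle at `e`. It exists since the plane is simply connected. The functions of the edges around
a vertex sum to one, and those of the edges around a face `f` to the number of white vertices of `f`
minus one, except at the vertex and at the face themselves.

Since the plane has only one end, the cyclic orders at the vertices determine `h e` at infinity,
where it takes two consecutive values `c e` and `c e + 1`. Comparing with the previous sums,
`c` has a nonpositive sum around each vertex and a nonnegative one around each face. On the other
hand, the functions attached to the two ends of a parallel bigon sum to the indicator function of
its interior, so that `c` has sum `-1` over these ends. A discrete Gauss–Bonnet formula for the
bigon then yields a contradiction. -/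

section Permutation

variable {D A : Type*} {σ : Equiv.Perm D}

theorem apply_eq_of_sameCycle {g : D → A} (hg : ∀ d, g (σ d) = g d) {d e : D}
    (h : σ.SameCycle d e) : g d = g e := by
  obtain ⟨i, rfl⟩ := h
  induction i using Int.induction_on with
  | zero => rfl
  | succ i ih => rw [ih, add_comm, zpow_add, zpow_one, Equiv.Perm.mul_apply, hg]
  | pred i ih => rw [ih, ← hg ((σ ^ (-(i : ℤ) - 1)) d), ← Equiv.Perm.mul_apply,
      mul_self_zpow, sub_add_cancel]

theorem minimalPeriod_pos_of_finite_sameCycle {d : D} (h : {e | σ.SameCycle d e}.Finite) :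
    0 < Function.minimalPeriod σ d := by
  have hmaps : ∀ i : ℕ, (σ ^ i) d ∈ {e | σ.SameCycle d e} := fun i => ⟨i, by simp⟩
  obtain ⟨i, j, hij, he⟩ := h.exists_lt_map_eq_of_forall_mem hmaps
  refine Function.minimalPeriod_pos_of_mem_periodicPts ⟨j - i, by omega, ?_⟩
  rw [Function.IsPeriodicPt, Function.IsFixedPt, Equiv.Perm.iterate_eq_pow]
  apply (σ ^ i).injective
  rw [← Equiv.Perm.mul_apply, ← pow_add, Nat.add_sub_cancel' hij.le, he]

theorem pow_minimalPeriod_apply (σ : Equiv.Perm D) (d : D) :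
    (σ ^ Function.minimalPeriod σ d) d = d := by
  rw [← Equiv.Perm.iterate_eq_pow]
  exact Function.iterate_minimalPeriod

theorem exists_pow_eq_of_finite_sameCycle {d e : D} (hfin : {e | σ.SameCycle d e}.Finite)
    (h : σ.SameCycle d e) : ∃ i < Function.minimalPeriod σ d, (σ ^ i) d = e := by
  obtain ⟨i, rfl⟩ := h
  have hpos := minimalPeriod_pos_of_finite_sameCycle hfin
  set n := Function.minimalPeriod σ d
  have hfix (k : ℤ) : (σ ^ ((n : ℤ) * k)) d = d := by
    rw [zpow_mul, zpow_natCast]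
    exact Function.IsFixedPt.perm_zpow (pow_minimalPeriod_apply σ d) k
  have hnonneg : 0 ≤ i % n := Int.emod_nonneg _ (by omega)
  have hlt : i % n < n := Int.emod_lt_of_pos i (by omega)
  refine ⟨(i % n).toNat, by omega, ?_⟩
  rw [← zpow_natCast, Int.toNat_of_nonneg hnonneg]
  conv_rhs => rw [← Int.emod_add_mul_ediv i n, zpow_add, Equiv.Perm.mul_apply, hfix]

theorem sum_sameCycle_eq_sum_range [AddCommMonoid A] {d : D}
    (hfin : {e | σ.SameCycle d e}.Finite) (φ : D → A) :
    ∑ e ∈ hfin.toFinset, φ e =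
      ∑ i ∈ Finset.range (Function.minimalPeriod σ d), φ ((σ ^ i) d) := by
  symm
  refine Finset.sum_bij (fun i _ => (σ ^ i) d) (fun i _ => hfin.mem_toFinset.2 ⟨i, by simp⟩) ?_ ?_
    (fun _ _ => rfl)
  · intro i hi j hj hij
    simp only [← Equiv.Perm.iterate_eq_pow] at hij
    exact Function.iterate_injOn_Iio_minimalPeriod (Finset.mem_range.1 hi)
      (Finset.mem_range.1 hj) hij
  · intro e he
    obtain ⟨i, hi, rfl⟩ := exists_pow_eq_of_finite_sameCycle hfin (by simpa using he)
    exact ⟨i, Finset.mem_range.2 hi, rfl⟩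

theorem exists_apply_eq_add_of_sum_eq_zero {K : Type*} [Field K] [CharZero K]
    (hfin : ∀ d, {e | σ.SameCycle d e}.Finite) {χ : D → K}
    (hχ : ∀ d, ∑ e ∈ (hfin d).toFinset, χ e = 0) :
    ∃ g : D → K, ∀ d, g (σ d) = g d + χ d := by
  -- The average of the partial sums of `-χ` along the cycle, over all lengths less than the period.
  refine ⟨fun d => (∑ i ∈ Finset.range (Function.minimalPeriod σ d), (i : K) * χ ((σ ^ i) d)) /
    (Function.minimalPeriod σ d : K), fun d => ?_⟩
  have hpos := minimalPeriod_pos_of_finite_sameCycle (hfin d)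
  have hper : Function.minimalPeriod σ (σ d) = Function.minimalPeriod σ d :=
    Function.minimalPeriod_apply (Function.minimalPeriod_pos_iff_mem_periodicPts.1 hpos)
  have hend := pow_minimalPeriod_apply σ d
  have hsum := hχ d
  rw [sum_sameCycle_eq_sum_range] at hsum
  simp only [hper]
  set n := Function.minimalPeriod σ d
  have hn0 : (n : K) ≠ 0 := Nat.cast_ne_zero.2 hpos.ne'
  have hshift (k : ℕ) : ∑ i ∈ Finset.range k, (i : K) * χ ((σ ^ i) (σ d)) =
      (∑ i ∈ Finset.range k, (i : K) * χ ((σ ^ i) d)) + (k - 1) * χ ((σ ^ k) d) + χ d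
        - ∑ i ∈ Finset.range k, χ ((σ ^ i) d) := by
    induction k with
    | zero => simp
    | succ k ih =>
      rw [Finset.sum_range_succ, ih, Finset.sum_range_succ, Finset.sum_range_succ, pow_succ σ k,
        Equiv.Perm.mul_apply]
      push_cast
      ring
  rw [hshift, hend, hsum]
  field_simp
  ring

end Permutation

namespace PlaneMap

variable {D : Type*} {M : PlaneMap D}

theorem faceNext_apply (d : D) : M.faceNext d = M.rot.symm (M.rev d) := rfl

theorem rot_faceNext (d : D) : M.rot (M.faceNext d) = M.rev d := by
  simp only [faceNext_apply, Equiv.apply_symm_apply]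

theorem faceNext_rev (d : D) : M.faceNext (M.rev d) = M.rot.symm d := by
  rw [faceNext_apply, M.rev_rev]

theorem vertexOf_eq_iff {d e : D} : M.vertexOf d = M.vertexOf e ↔ M.SameVertex d e :=
  ⟨fun h => Quotient.exact (s := Equiv.Perm.SameCycle.setoid M.rot) h,
    fun h => Quotient.sound (s := Equiv.Perm.SameCycle.setoid M.rot) h⟩

theorem faceOf_eq_iff {d e : D} : M.faceOf d = M.faceOf e ↔ M.SameFace d e :=
  ⟨fun h => Quotient.exact (s := Equiv.Perm.SameCycle.setoid M.faceNext) h,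
    fun h => Quotient.sound (s := Equiv.Perm.SameCycle.setoid M.faceNext) h⟩

theorem vertexOf_rot (d : D) : M.vertexOf (M.rot d) = M.vertexOf d :=
  vertexOf_eq_iff.2 (Equiv.Perm.SameCycle.symm ⟨1, by simp⟩)

theorem vertexOf_rot_symm (d : D) : M.vertexOf (M.rot.symm d) = M.vertexOf d := by
  rw [← vertexOf_rot, Equiv.apply_symm_apply]

theorem vertexOf_faceNext (d : D) : M.vertexOf (M.faceNext d) = M.vertexOf (M.rev d) :=
  vertexOf_rot_symm _

theorem faceOf_faceNext (d : D) : M.faceOf (M.faceNext d) = M.faceOf d :=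
  faceOf_eq_iff.2 (Equiv.Perm.SameCycle.symm ⟨1, by simp⟩)

/-- The list of darts is a walk from the origin of the first dart to the origin of the second. -/
def Joins (M : PlaneMap D) : D → List D → D → Prop
  | a, [], b => M.SameVertex a b
  | a, e :: l, b => M.SameVertex a e ∧ Joins M (M.rev e) l b

theorem Joins.congr_left {a a' : D} (h : M.SameVertex a' a) {l : List D} {b : D}
    (hl : M.Joins a l b) : M.Joins a' l b := by
  cases l with
  | nil => exact Equiv.Perm.SameCycle.trans h hl
  | cons e l => exact ⟨Equiv.Perm.SameCycle.trans h hl.1, hl.2⟩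

theorem Joins.append {l l' : List D} {a b c : D} (h : M.Joins a l b) (h' : M.Joins b l' c) :
    M.Joins a (l ++ l') c := by
  induction l generalizing a with
  | nil => exact h'.congr_left h
  | cons e l ih => exact ⟨h.1, ih h.2⟩

theorem Joins.reverse {l : List D} {a b : D} (h : M.Joins a l b) :
    M.Joins b (l.map M.rev).reverse a := by
  induction l generalizing a with
  | nil => exact Equiv.Perm.SameCycle.symm h
  | cons e l ih =>
    rw [List.map_cons, List.reverse_cons]
    refine (ih h.2).append ⟨Equiv.Perm.SameCycle.refl _ _, ?_⟩
    rw [M.rev_rev]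
    exact Equiv.Perm.SameCycle.symm h.1

theorem Joins.ends {l : List D} {a b : D} (h : M.Joins a l b) :
    M.IsWalk l ∧ (∀ x ∈ l.head?, M.SameVertex a x) ∧
      ∀ x ∈ l.getLast?, M.SameVertex (M.rev x) b := by
  induction l generalizing a with
  | nil => simp [IsWalk]
  | cons e l ih =>
    obtain ⟨hwalk, hhead, hlast⟩ := ih h.2
    refine ⟨List.isChain_cons.2 ⟨fun y hy => hhead y hy, hwalk⟩, by simpa using h.1, ?_⟩
    cases l with
    | nil => simpa using show M.SameVertex (M.rev e) b from h.2
    | cons e' l => simpa using hlast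

theorem Joins.isClosedWalk {l : List D} {a : D} (h : M.Joins a l a) : M.IsClosedWalk l :=
  ⟨h.ends.1, fun x hx y hy => Equiv.Perm.SameCycle.trans (h.ends.2.2 x hx) (h.ends.2.1 y hy)⟩

/-- The condition for a function on the corners to be a difference of values at the vertex and at
the face of each corner: it sums to zero around each quadrilateral of the quad-graph. -/
def IsCornerClosed (M : PlaneMap D) {A : Type*} [AddCommGroup A] (η : D → A) : Prop :=
  ∀ d, η (M.rot.symm d) + η (M.rot.symm (M.rev d)) = η d + η (M.rev d)

section Cohomology

variable {A : Type*} [AddCommGroup A] {c : D → A}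

theorem Homotopic.sum_eq (hrev : ∀ d, c (M.rev d) = -c d)
    (hface : ∀ d, ((M.faceWalk d).map c).sum = 0) {l l' : List D} (h : M.Homotopic l l') :
    (l.map c).sum = (l'.map c).sum := by
  induction h with
  | refl l => rfl
  | symm _ ih => exact ih.symm
  | trans _ _ ih₁ ih₂ => exact ih₁.trans ih₂
  | spur u d w _ => simp [hrev]
  | face u d w _ => simp [hface]

theorem sum_map_reverse (hrev : ∀ d, c (M.rev d) = -c d) (l : List D) :
    ((l.map M.rev).reverse.map c).sum = -(l.map c).sum := by
  induction l with
  | nil => simp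
  | cons e l ih =>
    rw [List.map_cons, List.reverse_cons, List.map_append, List.sum_append, ih]
    simp [hrev]

theorem sum_faceWalk_sub (η : D → A) (d : D) :
    ((M.faceWalk d).map (fun d => η (M.faceNext d) - η d)).sum = 0 := by
  have hpartial (n : ℕ) : (((List.range n).map fun i => (M.faceNext ^ i) d).map
      (fun d => η (M.faceNext d) - η d)).sum = η ((M.faceNext ^ n) d) - η d := by
    induction n with
    | zero => simp
    | succ n ih =>
      rw [List.range_succ, List.map_append, List.map_append, List.sum_append, ih]
      simp [pow_succ']
  rw [faceWalk, hpartial, pow_minimalPeriod_apply, sub_self]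

namespace IsPlanar

theorem exists_joins (hM : M.IsPlanar) (a b : D) : ∃ l, M.Joins a l b := by
  induction hM.connected a b with
  | refl => exact ⟨[], Equiv.Perm.SameCycle.refl _ _⟩
  | @tail b c _ hbc ih =>
    obtain ⟨l, hl⟩ := ih
    rcases hbc with rfl | rfl
    · exact ⟨l ++ [b], hl.append ⟨Equiv.Perm.SameCycle.refl _ _, Equiv.Perm.SameCycle.refl _ _⟩⟩
    · exact ⟨l ++ [], hl.append (l' := []) ⟨1, by simp⟩⟩

theorem sum_eq_of_joins (hM : M.IsPlanar) (hrev : ∀ d, c (M.rev d) = -c d)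
    (hface : ∀ d, ((M.faceWalk d).map c).sum = 0) {a b : D} {l l' : List D}
    (h : M.Joins a l b) (h' : M.Joins a l' b) : (l.map c).sum = (l'.map c).sum := by
  have hsum := (hM.simplyConnected _ (h.append h'.reverse).isClosedWalk).sum_eq hrev hface
  rw [List.map_append, List.sum_append, sum_map_reverse hrev] at hsum
  simpa [add_neg_eq_zero] using hsum

/-- The first cohomology group of a plane map vanishes. -/
theorem exists_primitive (hM : M.IsPlanar) (hrev : ∀ d, c (M.rev d) = -c d)
    (hface : ∀ d, ((M.faceWalk d).map c).sum = 0) :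
    ∃ p : D → A, (∀ d, p (M.rot d) = p d) ∧ ∀ d, p (M.rev d) = p d + c d := by
  have := hM.infinite
  obtain ⟨a⟩ : Nonempty D := inferInstance
  choose w hw using hM.exists_joins a
  refine ⟨fun d => ((w d).map c).sum, fun d => ?_, fun d => ?_⟩
  · refine hM.sum_eq_of_joins hrev hface (hw _) ?_
    simpa using (hw d).append (l' := []) (c := M.rot d) ⟨1, by simp⟩
  · simpa using hM.sum_eq_of_joins hrev hface (hw _) ((hw d).append (l' := [d])
      ⟨Equiv.Perm.SameCycle.refl _ _, Equiv.Perm.SameCycle.refl _ _⟩)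

end IsPlanar

end Cohomology

namespace IsPlanar

theorem eq_of_forall_corner (hM : M.IsPlanar) {A : Type*} {H : M.Vertex ⊕ M.Face → A}
    (h : ∀ d, H (.inl (M.vertexOf d)) = H (.inr (M.faceOf d))) (q r : M.Vertex ⊕ M.Face) :
    H q = H r := by
  have hrev (d : D) : H (.inl (M.vertexOf (M.rev d))) = H (.inl (M.vertexOf d)) := by
    rw [h d, ← faceOf_faceNext, ← h, vertexOf_faceNext]
  have hvertex (d e : D) : H (.inl (M.vertexOf e)) = H (.inl (M.vertexOf d)) := by
    induction hM.connected d e with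
    | refl => rfl
    | tail _ hbc ih =>
      rcases hbc with rfl | rfl
      · rw [hrev, ih]
      · rw [vertexOf_rot, ih]
  have hcorner (q : M.Vertex ⊕ M.Face) : ∃ d, H q = H (.inl (M.vertexOf d)) := by
    rcases q with q | q <;> induction q using Quotient.inductionOn with | h d => ?_
    · exact ⟨d, rfl⟩
    · exact ⟨d, (h d).symm⟩
  obtain ⟨⟨d, hd⟩, e, he⟩ := hcorner q, hcorner r
  rw [hd, he, hvertex]

theorem exists_cornerPotential (hM : M.IsPlanar) {A : Type*} [AddCommGroup A] {η : D → A}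
    (h : M.IsCornerClosed η) :
    ∃ H : M.Vertex ⊕ M.Face → A, ∀ d, H (.inl (M.vertexOf d)) - H (.inr (M.faceOf d)) = η d := by
  have hrev (d : D) : η (M.faceNext (M.rev d)) - η (M.rev d) = -(η (M.faceNext d) - η d) := by
    rw [faceNext_rev, faceNext_apply, neg_sub, sub_eq_sub_iff_add_eq_add, h d]
  obtain ⟨p, hrot, hrev⟩ := hM.exists_primitive hrev (sum_faceWalk_sub η)
  have hface (d : D) : p (M.faceNext d) - η (M.faceNext d) = p d - η d := by
    rw [← hrot, rot_faceNext, hrev]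
    abel
  refine ⟨Sum.elim (Quotient.lift p fun d e hde => apply_eq_of_sameCycle hrot hde)
    (Quotient.lift (fun d => p d - η d) fun d e hde =>
      apply_eq_of_sameCycle (g := fun d => p d - η d) hface hde),
    fun d => ?_⟩
  exact sub_sub_cancel (p d) (η d)

/-- The set of darts with the same origin as `d`. -/
noncomputable def vertexDarts (hM : M.IsPlanar) (d : D) : Finset D := (hM.vertex_finite d).toFinset

/-- The set of darts with the same face on their left as `d`. -/
noncomputable def faceDarts (hM : M.IsPlanar) (d : D) : Finset D := (hM.face_finite d).toFinset

theorem mem_vertexDarts (hM : M.IsPlanar) {d e : D} :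
    e ∈ hM.vertexDarts d ↔ M.vertexOf e = M.vertexOf d := by
  rw [vertexDarts, Set.Finite.mem_toFinset, eq_comm, vertexOf_eq_iff, Set.mem_ofPred_eq]

theorem mem_faceDarts (hM : M.IsPlanar) {d e : D} :
    e ∈ hM.faceDarts d ↔ M.faceOf e = M.faceOf d := by
  rw [faceDarts, Set.Finite.mem_toFinset, eq_comm, faceOf_eq_iff, Set.mem_ofPred_eq]

/-- The first cohomology of the medial graph vanishes, with rational coefficients. -/
theorem exists_medialPotential (hM : M.IsPlanar) {K : Type*} [Field K] [CharZero K] {χ : D → K}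
    (hvertex : ∀ d, ∑ e ∈ hM.vertexDarts d, χ e = 0) (hface : ∀ d, ∑ e ∈ hM.faceDarts d, χ e = 0) :
    ∃ ψ : D → K, (∀ d, ψ (M.rev d) = ψ d) ∧ ∀ d, ψ (M.rot d) = ψ d + χ d := by
  obtain ⟨g, hg⟩ := exists_apply_eq_add_of_sum_eq_zero hM.vertex_finite hvertex
  obtain ⟨k, hk⟩ := exists_apply_eq_add_of_sum_eq_zero hM.face_finite hface
  have hgk (d : D) : g (M.rev d) - g d =
      (g (M.faceNext d) + k (M.faceNext (M.faceNext d))) - (g d + k (M.faceNext d)) := by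
    rw [hk (M.faceNext d), ← rot_faceNext, hg]
    ring
  obtain ⟨p, hrot, hrev⟩ := hM.exists_primitive (c := fun d => g (M.rev d) - g d)
    (fun d => by rw [M.rev_rev, neg_sub])
    (fun d => by simpa only [hgk] using sum_faceWalk_sub (fun d => g d + k (M.faceNext d)) d)
  refine ⟨fun d => g d - p d, fun d => ?_, fun d => ?_⟩
  · simp only [hrev]; ring
  · simp only [hrot, hg]; ring

/-- The space of finite corner functions spanned by the indicators of the corners around a vertex
and those of the corners of a face. -/
noncomputable def starSpan (hM : M.IsPlanar) : Submodule ℚ (D →₀ ℚ) :=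
  .span ℚ (Set.range (fun d => ∑ e ∈ hM.vertexDarts d, Finsupp.single e 1) ∪
    Set.range (fun d => ∑ e ∈ hM.faceDarts d, Finsupp.single e 1))

theorem mem_starSpan (hM : M.IsPlanar) {z : D →₀ ℚ} (hz : M.IsCornerClosed z) :
    z ∈ hM.starSpan := by
  by_contra hmem
  -- A functional separating `z` from the span is a corner function with primitive `ψ` on the medial
  -- graph; pairing it with `z` amounts to pairing `ψ` with the variation `w` of `z` across edges.
  obtain ⟨F, hFz, hker⟩ := Submodule.exists_le_ker_of_notMem hmem
  have hgen {S : Finset D} (hS : ∑ e ∈ S, Finsupp.single e 1 ∈ hM.starSpan) :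
      ∑ e ∈ S, F (Finsupp.single e 1) = 0 := by
    rw [← map_sum]
    exact hker hS
  obtain ⟨ψ, hrev, hrot⟩ := hM.exists_medialPotential
    (fun d => hgen (Submodule.subset_span (.inl ⟨d, rfl⟩)))
    (fun d => hgen (Submodule.subset_span (.inr ⟨d, rfl⟩)))
  let pair (ψ : D → ℚ) : (D →₀ ℚ) →ₗ[ℚ] ℚ := Finsupp.linearCombination ℚ ψ
  have hF : F = pair (ψ ∘ M.rot) - pair ψ := by
    ext d
    simp [pair, hrot]
  let w : D →₀ ℚ := z.mapDomain M.rot - z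
  have hw : w.mapDomain M.rev = -w := by
    have hrevSymm : M.rev.symm = M.rev := by
      ext d
      rw [Equiv.symm_apply_eq, M.rev_rev]
    ext d
    simp only [w, ← Finsupp.equivMapDomain_eq_mapDomain, Finsupp.equivMapDomain_apply,
      Finsupp.coe_sub, Finsupp.coe_neg, Pi.sub_apply, Pi.neg_apply, hrevSymm]
    linear_combination hz d
  have hanti : pair ψ w = -pair ψ w := by
    conv_lhs => rw [← funext hrev]
    rw [← map_neg, ← hw]
    exact (Finsupp.linearCombination_mapDomain ℚ M.rev w).symm
  apply hFz
  calc F z = pair ψ (z.mapDomain M.rot) - pair ψ z := by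
        rw [hF, LinearMap.sub_apply]
        congr 1
        exact (Finsupp.linearCombination_mapDomain ℚ M.rot z).symm
    _ = pair ψ w := (map_sub _ _ _).symm
    _ = 0 := by linarith

theorem exists_cornerPotential_of_mem_starSpan (hM : M.IsPlanar) {z : D →₀ ℚ}
    (hz : z ∈ hM.starSpan) :
    ∃ H : M.Vertex ⊕ M.Face →₀ ℚ, ∀ d, H (.inl (M.vertexOf d)) - H (.inr (M.faceOf d)) = z d := by
  classical
  have hstar (S : Finset D) (d : D) :
      (∑ e ∈ S, Finsupp.single e (1 : ℚ)) d = if d ∈ S then 1 else 0 := by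
    simp [Finsupp.finsetSum_apply, Finsupp.single_apply]
  induction hz using Submodule.span_induction with
  | mem z hz =>
    rcases hz with ⟨d, rfl⟩ | ⟨d, rfl⟩
    · refine ⟨.single (.inl (M.vertexOf d)) 1, fun e => ?_⟩
      simp [hstar, Finsupp.single_apply, mem_vertexDarts, eq_comm]
    · refine ⟨.single (.inr (M.faceOf d)) (-1), fun e => ?_⟩
      simp [hstar, Finsupp.single_apply, mem_faceDarts, eq_comm]
  | zero => exact ⟨0, by simp⟩
  | add z z' _ _ h h' =>
    obtain ⟨⟨H, hH⟩, H', hH'⟩ := h, h'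
    exact ⟨H + H', fun d => by
      simp only [Finsupp.add_apply, ← hH, ← hH']
      ring⟩
  | smul a z _ h =>
    obtain ⟨H, hH⟩ := h
    exact ⟨a • H, fun d => by simp only [Finsupp.smul_apply, ← hH, smul_sub]⟩

/-- The first cohomology group with compact supports vanishes: the plane has only one end. -/
theorem exists_eventually_eq_const (hM : M.IsPlanar) {H : M.Vertex ⊕ M.Face → ℤ}
    (h : ∀ᶠ d in Filter.cofinite, H (.inl (M.vertexOf d)) = H (.inr (M.faceOf d))) :
    ∃ c, ∀ᶠ q in Filter.cofinite, H q = c := by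
  let η (d : D) : ℚ := H (.inl (M.vertexOf d)) - H (.inr (M.faceOf d))
  have hfin : η.support.Finite := (Filter.eventually_cofinite.1 h).subset fun d hd heq =>
    hd (by simp only [η, heq, sub_self])
  have hclosed : M.IsCornerClosed η := fun d => by
    simp only [η, ← faceNext_apply, ← faceNext_rev d, faceOf_faceNext,
      vertexOf_faceNext, M.rev_rev]
    ring
  obtain ⟨H', hH'⟩ := hM.exists_cornerPotential_of_mem_starSpan
    (hM.mem_starSpan (z := Finsupp.ofSupportFinite η hfin) hclosed)
  have hconst := hM.eq_of_forall_corner (H := fun q => (H q : ℚ) - H' q) fun d => by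
    have : H' (.inl (M.vertexOf d)) - H' (.inr (M.faceOf d)) = η d := hH' d
    linear_combination -this
  have hzero : ∀ᶠ q in Filter.cofinite, H' q = 0 := Filter.eventually_cofinite.2
    (H'.hasFiniteSupport.subset fun q hq => Function.mem_support.2 hq)
  by_cases hex : ∃ q, H' q = 0
  · obtain ⟨r, hr⟩ := hex
    refine ⟨H r, hzero.mono fun q hq => ?_⟩
    have := hconst q r
    rw [hq, hr, sub_zero, sub_zero] at this
    exact_mod_cast this
  · exact ⟨0, hzero.mono fun q hq => absurd ⟨q, hq⟩ hex⟩

end IsPlanar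

end PlaneMap

namespace BipartitePlaneGraph

open Filter

variable {D : Type*} {G : BipartitePlaneGraph D}

attribute [simp] PlaneMap.rev_rev white_rot white_rev

@[simp]
theorem white_rot_symm (d : D) : G.white (G.rot.symm d) = G.white d := by
  rw [← G.white_rot, Equiv.apply_symm_apply]

@[simp]
theorem white_faceNext (d : D) : G.white (G.faceNext d) = !G.white d := by
  rw [PlaneMap.faceNext_apply, white_rot_symm, white_rev]

theorem nextStrand_of_white {s : D} (hs : G.white s = true) :
    G.nextStrand s = G.faceNext (G.rot s) := by
  simp only [nextStrand, Equiv.coe_fn_mk, hs, if_true, PlaneMap.faceNext_apply]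

theorem nextStrand_of_black {s : D} (hs : G.white s = false) : G.nextStrand s = G.rev s := by
  simp [nextStrand, hs]

@[simp]
theorem white_nextStrand (s : D) : G.white (G.nextStrand s) = !G.white s := by
  cases hs : G.white s
  · simp [nextStrand_of_black hs, hs]
  · simp [nextStrand_of_white hs, hs]

@[simp]
theorem white_exitEdge (s : D) : G.white (G.exitEdge s) = true := by
  rw [exitEdge]
  cases hs : G.white s <;> simp [hs]

theorem nextStrand_rot_symm {e : D} (he : G.white e = true) :
    G.nextStrand (G.rot.symm e) = G.faceNext e := by
  rw [nextStrand_of_white (by simpa using he), Equiv.apply_symm_apply]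

theorem nextStrand_rev {e : D} (he : G.white e = true) : G.nextStrand (G.rev e) = e := by
  rw [nextStrand_of_black (by simp [he]), G.rev_rev]

theorem nextStrand_faceNext {e : D} (he : G.white e = false) :
    G.nextStrand (G.faceNext e) = G.rot.symm e := by
  rw [nextStrand_of_white (by simp [he]), PlaneMap.rot_faceNext, PlaneMap.faceNext_rev]

variable (G) in
/-- The sign attached to a dart according to the colour of its origin, i.e. the sense of rotation
of the corresponding strand around this vertex. -/
def colourSign (s : D) : ℤ := if G.white s then 1 else -1

@[simp]
theorem colourSign_mul_self (s : D) : G.colourSign s * G.colourSign s = 1 := by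
  rw [colourSign]
  split_ifs <;> rfl

@[simp]
theorem colourSign_rot (s : D) : G.colourSign (G.rot s) = G.colourSign s := by
  simp [colourSign]

@[simp]
theorem colourSign_rev (s : D) : G.colourSign (G.rev s) = -G.colourSign s := by
  cases hs : G.white s <;> simp [colourSign, hs]

@[simp]
theorem colourSign_faceNext (s : D) : G.colourSign (G.faceNext s) = -G.colourSign s := by
  cases hs : G.white s <;> simp [colourSign, hs]

variable (G) in
/-- The face of the graph of train-tracks on the left (`b = true`) or on the right (`b = false`) of
a strand. A strand turning around a vertex of colour `b` has this vertex on the side `b`. -/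
def sideOf (b : Bool) (s : D) : G.QuadVertex :=
  if G.white s = b then .inl (G.vertexOf s) else .inr (G.faceOf s)

variable (G) in
/-- The jump of an integer function on the faces of the graph of train-tracks across each strand,
from right to left. -/
def jump : (G.QuadVertex → ℤ) →+ (D → ℤ) where
  toFun H s := G.colourSign s * (H (.inl (G.vertexOf s)) - H (.inr (G.faceOf s)))
  map_zero' := by ext; simp
  map_add' H H' := by ext; simp only [Pi.add_apply]; ring

theorem jump_apply (H : G.QuadVertex → ℤ) (s : D) :
    G.jump H s = G.colourSign s * (H (.inl (G.vertexOf s)) - H (.inr (G.faceOf s))) := rfl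

theorem jump_apply_eq_sideOf (H : G.QuadVertex → ℤ) (s : D) :
    G.jump H s = H (G.sideOf true s) - H (G.sideOf false s) := by
  cases hs : G.white s <;> simp [jump_apply, colourSign, sideOf, hs]

theorem jump_apply_eq_zero {H : G.QuadVertex → ℤ} {s : D} :
    G.jump H s = 0 ↔ H (.inl (G.vertexOf s)) = H (.inr (G.faceOf s)) := by
  rw [jump_apply, mul_eq_zero_iff_left (left_ne_zero_of_mul_eq_one (colourSign_mul_self s)),
    sub_eq_zero]

open Classical in
theorem jump_single_vertex (d : D) : G.jump (Pi.single (.inl (G.vertexOf d)) 1) =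
    ∑ e ∈ G.planar.vertexDarts d, G.colourSign e • Pi.single e 1 := by
  ext s
  simp [jump_apply, Pi.single_apply, Finset.sum_apply, G.planar.mem_vertexDarts]

open Classical in
theorem jump_single_face (d : D) : G.jump (Pi.single (.inr (G.faceOf d)) 1) =
    -∑ e ∈ G.planar.faceDarts d, G.colourSign e • Pi.single e 1 := by
  ext s
  simp [jump_apply, Pi.single_apply, Finset.sum_apply, G.planar.mem_faceDarts]

theorem eq_of_jump_eq_zero {H : G.QuadVertex → ℤ} (hH : G.jump H = 0) (q r : G.QuadVertex) :
    H q = H r :=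
  G.planar.eq_of_forall_corner (fun d => jump_apply_eq_zero.1 (congrFun hH d)) q r

theorem exists_eventually_eq_const {H : G.QuadVertex → ℤ} (hH : G.jump H =ᶠ[cofinite] 0) :
    ∃ c, ∀ᶠ q in cofinite, H q = c :=
  G.planar.exists_eventually_eq_const (hH.mono fun _ => jump_apply_eq_zero.1)

variable (G) in
/-- The boundary of a chain of strands: at a dart with white origin, the sum over the two strands
leaving its edge minus the sum over the two strands arriving there. It is extended to all darts so
as to be antisymmetric under reversal. -/
def boundary : (D → ℤ) →+ (D → ℤ) where
  toFun z e := z e + z (G.faceNext e) - z (G.rev e) - z (G.faceNext (G.rev e))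
  map_zero' := by ext; simp
  map_add' z z' := by ext; simp only [Pi.add_apply]; ring

theorem boundary_apply (z : D → ℤ) (e : D) :
    G.boundary z e = z e + z (G.faceNext e) - z (G.rev e) - z (G.faceNext (G.rev e)) := rfl

theorem exists_jump_eq {z : D → ℤ} (hz : G.boundary z = 0) (q : G.QuadVertex) :
    ∃ H, G.jump H = z ∧ H q = 0 := by
  obtain ⟨H, hH⟩ := G.planar.exists_cornerPotential (η := fun d => G.colourSign d * z d) fun d => by
    have := congrFun hz d
    rw [boundary_apply, Pi.zero_apply] at this
    simp only [← PlaneMap.faceNext_apply, ← PlaneMap.faceNext_rev d, colourSign_faceNext,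
      colourSign_rev]
    linear_combination -G.colourSign d * this
  refine ⟨fun r => H r - H q, funext fun s => ?_, sub_self _⟩
  rw [jump_apply, sub_sub_sub_cancel_right, hH, ← mul_assoc, colourSign_mul_self, one_mul]

variable (G) in
open Classical in
/-- The class of an edge among antisymmetric functions of darts, in which boundaries live; it does
not depend on the dart representing the edge. -/
noncomputable def edgeClass (d : D) : D → ℤ :=
  G.colourSign d • (Pi.single d 1 - Pi.single (G.rev d) 1)

theorem edgeClass_rev (d : D) : G.edgeClass (G.rev d) = G.edgeClass d := by
  rw [edgeClass, edgeClass, colourSign_rev, G.rev_rev, neg_smul, ← smul_neg, neg_sub]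

open Classical in
theorem edgeClass_apply (d e : D) :
    G.edgeClass d e =
      G.colourSign d * ((if e = d then 1 else 0) - if G.rev e = d then 1 else 0) := by
  have hrev : e = G.rev d ↔ G.rev e = d := by
    rw [← G.rev.injective.eq_iff, G.rev_rev]
  simp [edgeClass, Pi.single_apply, hrev]

theorem edgeClass_rev_apply (d e : D) : G.edgeClass d (G.rev e) = -G.edgeClass d e := by
  rw [edgeClass_apply, edgeClass_apply, G.rev_rev]
  ring

theorem faceNext_eq_iff {d e : D} : G.faceNext e = d ↔ G.rev e = G.rot d := by
  rw [PlaneMap.faceNext_apply, Equiv.symm_apply_eq]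

open Classical in
theorem boundary_single (d : D) :
    G.boundary (Pi.single d 1) = G.colourSign d • (G.edgeClass d - G.edgeClass (G.rot d)) := by
  ext e
  simp only [boundary_apply, Pi.single_apply, Pi.smul_apply, Pi.sub_apply, edgeClass_apply,
    faceNext_eq_iff, G.rev_rev, colourSign_rot, smul_eq_mul, ← mul_sub, ← mul_assoc,
    colourSign_mul_self, one_mul]
  ring

section Ray

variable (G) in
/-- The indicator function of the strands following a given one on its train-track, including
itself. -/
noncomputable def ray (s : D) : D → ℤ := {u | ∃ n : ℕ, (G.nextStrand ^ n) s = u}.indicator 1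

open Classical in
theorem ray_apply (s u : D) :
    G.ray s u = if ∃ n : ℕ, (G.nextStrand ^ n) s = u then 1 else 0 := by
  simp [ray, Set.indicator_apply]

theorem ray_eq_one {s u : D} (n : ℕ) (h : (G.nextStrand ^ n) s = u) : G.ray s u = 1 := by
  rw [ray_apply, if_pos ⟨n, h⟩]

theorem ray_self (s : D) : G.ray s s = 1 := ray_eq_one 0 rfl

theorem ray_eq_zero {s u : D} (h : ∀ n : ℕ, (G.nextStrand ^ n) s ≠ u) : G.ray s u = 0 := by
  rw [ray_apply, if_neg (not_exists.2 h)]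

theorem SameTrack.pow (s : D) (n : ℕ) : G.SameTrack s ((G.nextStrand ^ n) s) := ⟨n, by simp⟩

theorem SameTrack.nextStrand (s : D) : G.SameTrack s (G.nextStrand s) := .pow s 1

theorem ray_eq_zero_of_not_sameTrack {s u : D} (h : ¬G.SameTrack s u) : G.ray s u = 0 :=
  ray_eq_zero fun n hn => h (hn ▸ .pow s n)

theorem NoTrackLoops.pow_injective (hloop : G.NoTrackLoops) (s : D) :
    Function.Injective fun n : ℕ => (G.nextStrand ^ n) s := by
  refine Function.Injective.of_lt_imp_ne fun m n hmn h => ?_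
  refine hloop ((G.nextStrand ^ m) s) (n - m) (by omega) ?_
  rw [← Equiv.Perm.mul_apply, ← pow_add, Nat.sub_add_cancel hmn.le]
  exact h.symm

theorem NoTrackLoops.ray_nextStrand_self (hloop : G.NoTrackLoops) (s : D) :
    G.ray (G.nextStrand s) s = 0 :=
  ray_eq_zero fun n hn => hloop s (n + 1) n.succ_pos (by rwa [pow_succ])

open Classical in
theorem NoTrackLoops.ray_eq_single_add (hloop : G.NoTrackLoops) (s : D) :
    G.ray s = Pi.single s 1 + G.ray (G.nextStrand s) := by
  ext u
  by_cases hu : u = s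
  · subst hu
    simp [ray_self, hloop.ray_nextStrand_self]
  · have hiff : (∃ n : ℕ, (G.nextStrand ^ n) s = u) ↔
        ∃ n : ℕ, (G.nextStrand ^ n) (G.nextStrand s) = u := by
      simp only [← Equiv.Perm.mul_apply, ← pow_succ]
      refine ⟨?_, fun ⟨n, hn⟩ => ⟨n + 1, hn⟩⟩
      rintro ⟨_ | n, hn⟩
      · exact absurd hn.symm hu
      · exact ⟨n, hn⟩
    simp [ray_apply, hiff, hu]

theorem ray_nextStrand_nextStrand (s u : D) :
    G.ray (G.nextStrand s) (G.nextStrand u) = G.ray s u := by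
  classical
  simp only [ray_apply, ← Equiv.Perm.mul_apply, ← pow_succ]
  simp only [pow_succ', Equiv.Perm.mul_apply, G.nextStrand.injective.eq_iff]

open Classical in
theorem NoTrackLoops.ray_nextStrand (hloop : G.NoTrackLoops) (s u : D) :
    G.ray s (G.nextStrand u) - G.ray s u = if G.nextStrand u = s then 1 else 0 := by
  have h := congrFun (hloop.ray_eq_single_add s) (G.nextStrand u)
  rw [Pi.add_apply, ray_nextStrand_nextStrand, Pi.single_apply] at h
  rw [h, add_sub_cancel_right]

theorem boundary_rev (z : D → ℤ) (e : D) : G.boundary z (G.rev e) = -G.boundary z e := by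
  simp only [boundary_apply, G.rev_rev]
  ring

open Classical in
theorem NoTrackLoops.boundary_ray_of_white (hloop : G.NoTrackLoops) (s : D) {e : D}
    (he : G.white e = true) :
    G.boundary (G.ray s) e = (if e = s then 1 else 0) + if G.rev e = G.rot s then 1 else 0 := by
  have hrev := hloop.ray_nextStrand s (G.rev e)
  have hrot := hloop.ray_nextStrand s (G.rot.symm e)
  rw [nextStrand_rev he] at hrev
  simp only [nextStrand_rot_symm he, faceNext_eq_iff] at hrot
  rw [boundary_apply, PlaneMap.faceNext_rev]
  linear_combination hrev + hrot

theorem NoTrackLoops.boundary_ray (hloop : G.NoTrackLoops) (s : D) :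
    G.boundary (G.ray s) = G.edgeClass (if G.white s then s else G.rot s) := by
  classical
  have hwhite {e : D} (he : G.white e = true) :
      G.boundary (G.ray s) e = G.edgeClass (if G.white s then s else G.rot s) e := by
    have hne {d d' : D} (h : G.white d ≠ G.white d') : d ≠ d' := fun h' => h (h' ▸ rfl)
    rw [hloop.boundary_ray_of_white s he]
    cases hs : G.white s
    · simp [edgeClass_apply, colourSign, hs, hne (d := e) (d' := s),
        hne (d := e) (d' := G.rot s), he, apply_ite (- · : ℤ → ℤ)]
    · simp [edgeClass_apply, colourSign, hs, hne (d := G.rev e) (d' := s),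
        hne (d := G.rev e) (d' := G.rot s), he]
  ext e
  cases he : G.white e
  · have h := hwhite (e := G.rev e) (by simp [he])
    rwa [boundary_rev, edgeClass_rev_apply, neg_inj] at h
  · exact hwhite he

theorem tendsto_sideOf (b : Bool) : Tendsto (G.sideOf b) cofinite cofinite := by
  refine Tendsto.cofinite_of_finite_preimage_singleton fun q => ?_
  rcases q with q | q <;> induction q using Quotient.inductionOn with | h d => ?_
  · refine (G.planar.vertexDarts d).finite_toSet.subset fun s hs => G.planar.mem_vertexDarts.2 ?_
    rw [Set.mem_preimage, Set.mem_singleton_iff, sideOf] at hs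
    split_ifs at hs
    exact Sum.inl_injective hs
  · refine (G.planar.faceDarts d).finite_toSet.subset fun s hs => G.planar.mem_faceDarts.2 ?_
    rw [Set.mem_preimage, Set.mem_singleton_iff, sideOf] at hs
    split_ifs at hs
    exact Sum.inr_injective hs

theorem NoTrackLoops.tendsto_pow (hloop : G.NoTrackLoops) (s : D) :
    Tendsto (fun n : ℕ => (G.nextStrand ^ n) s) atTop cofinite :=
  Nat.cofinite_eq_atTop ▸ (hloop.pow_injective s).tendsto_cofinite

theorem NoTrackLoops.ray_eventuallyEq (hloop : G.NoTrackLoops) {s t : D} (h : G.SameTrack s t) :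
    G.ray s =ᶠ[cofinite] G.ray t := by
  classical
  have hnext (s : D) : G.ray (G.nextStrand s) =ᶠ[cofinite] G.ray s := by
    filter_upwards [eventually_cofinite_ne s] with u hu
    simp [hloop.ray_eq_single_add s, hu]
  let germ (s : D) : Germ (cofinite : Filter D) ℤ := Germ.ofFun (G.ray s)
  have hgerm : germ s = germ t :=
    apply_eq_of_sameCycle (σ := G.nextStrand) (g := germ) (fun s => Germ.coe_eq.2 (hnext s)) h
  exact Germ.coe_eq.1 hgerm

end Ray

theorem sameTrack_rev (d : D) : G.SameTrack d (G.rev d) := by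
  cases hd : G.white d
  · exact nextStrand_of_black hd ▸ .nextStrand d
  · have h := SameTrack.nextStrand (G := G) (G.rev d)
    rw [nextStrand_rev hd] at h
    exact h.symm

theorem sameTrack_rot_symm_faceNext (d : D) : G.SameTrack (G.rot.symm d) (G.faceNext d) := by
  cases hd : G.white d
  · have h := SameTrack.nextStrand (G := G) (G.faceNext d)
    rw [nextStrand_faceNext hd] at h
    exact h.symm
  · exact nextStrand_rot_symm hd ▸ .nextStrand _

variable (G) in
/-- Two distinct strands end at the same edge, where their train-tracks cross. -/
def Crosses (u u' : D) : Prop := u ≠ u' ∧ G.exitEdge u = G.exitEdge u'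

theorem exitEdge_eq_iff {e : D} (he : G.white e = true) {u : D} :
    G.exitEdge u = e ↔ u = G.rot.symm e ∨ u = G.rev e := by
  have hne {d d' : D} (h : G.white d ≠ G.white d') : d ≠ d' := fun h' => h (h' ▸ rfl)
  rw [exitEdge, Equiv.eq_symm_apply, ← G.rev.injective.eq_iff (a := u), G.rev_rev]
  cases hu : G.white u
  · simp [hne (d := G.rot u) (d' := e), hu, he]
  · simp [hne (d := G.rev u) (d' := e), hu, he]

theorem crosses_rot_symm_rev {e : D} (he : G.white e = true) :
    G.Crosses (G.rot.symm e) (G.rev e) :=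
  ⟨fun h => by simpa [he] using congrArg G.white h,
    by rw [(exitEdge_eq_iff he).2 (.inl rfl), (exitEdge_eq_iff he).2 (.inr rfl)]⟩

namespace Crosses

variable {u u' : D}

theorem symm (h : G.Crosses u u') : G.Crosses u' u := ⟨h.1.symm, h.2.symm⟩

theorem exists_dart (h : G.Crosses u u') : ∃ e, G.white e = true ∧ G.exitEdge u = e ∧
    (u = G.rot.symm e ∧ u' = G.rev e ∨ u = G.rev e ∧ u' = G.rot.symm e) := by
  have he := white_exitEdge (G := G) u
  refine ⟨G.exitEdge u, he, rfl, ?_⟩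
  rcases (exitEdge_eq_iff he).1 rfl with hu | hu <;>
    rcases (exitEdge_eq_iff he).1 h.2.symm with hu' | hu'
  · exact absurd (hu.trans hu'.symm) h.1
  · exact .inl ⟨hu, hu'⟩
  · exact .inr ⟨hu, hu'⟩
  · exact absurd (hu.trans hu'.symm) h.1

theorem white_right (h : G.Crosses u u') : G.white u' = !G.white u := by
  obtain ⟨e, -, -, ⟨rfl, rfl⟩ | ⟨rfl, rfl⟩⟩ := h.exists_dart <;> simp

/-! Around the crossing of the strands `u` and `u'` there are four faces of the graph of
train-tracks, each of which is seen from two of the strands `u`, `u'`, `nextStrand u` and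
`nextStrand u'`. -/

theorem sideOf_nextStrand (h : G.Crosses u u') : G.sideOf (G.white u) (G.nextStrand u) =
    G.sideOf (!G.white u) (G.nextStrand u') := by
  obtain ⟨e, he, -, ⟨rfl, rfl⟩ | ⟨rfl, rfl⟩⟩ := h.exists_dart <;>
    simp [sideOf, nextStrand_rot_symm he, nextStrand_rev he, he, PlaneMap.faceOf_faceNext]

theorem sideOf_not (h : G.Crosses u u') :
    G.sideOf (!G.white u) u = G.sideOf (G.white u) u' := by
  obtain ⟨e, he, -, ⟨rfl, rfl⟩ | ⟨rfl, rfl⟩⟩ := h.exists_dart <;>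
    simp [sideOf, he, ← PlaneMap.faceNext_rev e, PlaneMap.faceOf_faceNext]

theorem sideOf_self (h : G.Crosses u u') :
    G.sideOf (G.white u) u = G.sideOf (G.white u) (G.nextStrand u') := by
  obtain ⟨e, he, -, ⟨rfl, rfl⟩ | ⟨rfl, rfl⟩⟩ := h.exists_dart <;>
    simp [sideOf, nextStrand_rot_symm he, nextStrand_rev he, he, PlaneMap.vertexOf_rot_symm,
      PlaneMap.vertexOf_faceNext]

theorem not_sameTrack (hadj : ∀ d, ¬G.SameTrack (G.rot.symm d) d) (h : G.Crosses u u') :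
    ¬G.SameTrack u u' := by
  obtain ⟨e, -, -, ⟨rfl, rfl⟩ | ⟨rfl, rfl⟩⟩ := h.exists_dart
  · exact fun h => hadj e (h.trans (sameTrack_rev e).symm)
  · exact fun h => hadj e (h.symm.trans (sameTrack_rev e).symm)

end Crosses

theorem exists_crosses (u : D) : ∃ u', G.Crosses u u' := by
  have he := white_exitEdge (G := G) u
  rcases (exitEdge_eq_iff he).1 rfl with hu | hu <;> rw [hu]
  · exact ⟨_, crosses_rot_symm_rev he⟩
  · exact ⟨_, (crosses_rot_symm_rev he).symm⟩

theorem not_hasSelfIntersection (hadj : ∀ d, ¬G.SameTrack (G.rot.symm d) d) :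
    ¬G.HasSelfIntersection := fun ⟨_, _, hne, htrack, hexit⟩ =>
  Crosses.not_sameTrack hadj ⟨hne, hexit⟩ htrack

section EdgePotential

variable (G) in
/-- A family of integer functions on the faces of the graph of train-tracks, indexed by the edges:
the function of an edge jumps across the two parts of train-tracks that leave this edge, and
vanishes on the three faces at this edge that are not between these two parts. -/
structure IsEdgePotential (h : D → G.QuadVertex → ℤ) : Prop where
  jump_of_white : ∀ d, G.white d = true → G.jump (h d) = G.ray (G.faceNext d) - G.ray d
  vertexOf_of_white : ∀ d, G.white d = true → h d (.inl (G.vertexOf d)) = 0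
  rev : ∀ d, h (G.rev d) = h d

theorem NoTrackLoops.exists_isEdgePotential (hloop : G.NoTrackLoops) :
    ∃ h, G.IsEdgePotential h := by
  have hexists {d : D} (hd : G.white d = true) :
      ∃ H, G.jump H = G.ray (G.faceNext d) - G.ray d ∧ H (.inl (G.vertexOf d)) = 0 := by
    refine exists_jump_eq ?_ _
    rw [map_sub, hloop.boundary_ray, hloop.boundary_ray, if_pos hd, if_neg (by simp [hd]),
      PlaneMap.rot_faceNext, edgeClass_rev, sub_self]
  choose! k hjump hvertex using fun d => hexists (d := d)
  refine ⟨fun d => if G.white d then k d else k (G.rev d), fun d hd => ?_, fun d hd => ?_,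
    fun d => ?_⟩
  · rw [if_pos hd, hjump d hd]
  · rw [if_pos hd, hvertex d hd]
  · cases hd : G.white d <;> simp [hd]

variable (G) in
/-- The part of the train-track of the strand `d` that follows the edge of `rot d`. -/
noncomputable def tailRay (d : D) : D → ℤ :=
  if G.white d then G.ray (G.nextStrand d) else G.ray d

theorem tailRay_rot_symm (d : D) : G.tailRay (G.rot.symm d) = G.tailRay (G.faceNext d) := by
  cases hd : G.white d
  · simp [tailRay, hd, nextStrand_faceNext hd]
  · simp [tailRay, hd, nextStrand_rot_symm hd]

namespace IsEdgePotential

variable {h : D → G.QuadVertex → ℤ}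

open Classical in
theorem jump_eq (hh : G.IsEdgePotential h) (hloop : G.NoTrackLoops) (d : D) :
    G.jump (h d) =
      G.tailRay (G.rot.symm d) - G.tailRay d - G.colourSign d • Pi.single d 1 := by
  have hray := hloop.ray_eq_single_add d
  cases hd : G.white d
  · rw [nextStrand_of_black hd] at hray
    rw [← hh.rev, hh.jump_of_white _ (by simp [hd]), PlaneMap.faceNext_rev]
    simp only [tailRay, white_rot_symm, hd, colourSign, hray]
    simp only [Bool.false_eq_true, ↓reduceIte, Int.reduceNeg, neg_smul, one_smul, sub_neg_eq_add]
    abel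
  · rw [hh.jump_of_white d hd, ← nextStrand_rot_symm hd, hray]
    simp only [tailRay, white_rot_symm, hd, ↓reduceIte, colourSign, one_smul]
    abel

theorem faceOf_of_white (hh : G.IsEdgePotential h) (hadj : ∀ d, ¬G.SameTrack (G.rot.symm d) d)
    {d : D} (hd : G.white d = true) : h d (.inr (G.faceOf d)) = 1 := by
  have hjump := congrFun (hh.jump_of_white d hd) d
  rw [jump_apply, hh.vertexOf_of_white d hd, Pi.sub_apply, ray_self, ray_eq_zero_of_not_sameTrack
    fun h => hadj d ((sameTrack_rot_symm_faceNext d).trans h)] at hjump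
  simpa [colourSign, hd] using hjump

theorem vertexOf_eq_zero (hh : G.IsEdgePotential h) (hadj : ∀ d, ¬G.SameTrack (G.rot.symm d) d)
    (d : D) : h d (.inl (G.vertexOf d)) = 0 := by
  cases hd : G.white d
  · have he : G.white (G.rev d) = true := by simp [hd]
    have hjump := congrFun (hh.jump_of_white _ he) (G.rot.symm d)
    rw [PlaneMap.faceNext_rev, jump_apply, Pi.sub_apply, ray_self, ray_eq_zero_of_not_sameTrack
      fun h => hadj d (h.symm.trans (sameTrack_rev d).symm), ← PlaneMap.faceNext_rev,
      PlaneMap.faceOf_faceNext, hh.faceOf_of_white hadj he, hh.rev, PlaneMap.faceNext_rev,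
      PlaneMap.vertexOf_rot_symm] at hjump
    simpa [colourSign, hd] using hjump
  · exact hh.vertexOf_of_white d hd

theorem faceOf_eq (hh : G.IsEdgePotential h) (hloop : G.NoTrackLoops)
    (hadj : ∀ d, ¬G.SameTrack (G.rot.symm d) d) (d : D) :
    h d (.inr (G.faceOf d)) = if G.white d then 1 else 0 := by
  cases hd : G.white d
  · have hjump := congrFun (hh.jump_eq hloop d) d
    simpa [jump_apply, hh.vertexOf_eq_zero hadj, tailRay, hd, colourSign, ray_self,
      ray_eq_zero_of_not_sameTrack (hadj d)] using hjump
  · simpa using hh.faceOf_of_white hadj hd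

open Classical in
theorem sum_vertexDarts (hh : G.IsEdgePotential h) (hloop : G.NoTrackLoops)
    (hadj : ∀ d, ¬G.SameTrack (G.rot.symm d) d) (d : D) :
    ∑ e ∈ G.planar.vertexDarts d, h e = 1 - Pi.single (.inl (G.vertexOf d)) 1 := by
  set H := ∑ e ∈ G.planar.vertexDarts d, h e + Pi.single (.inl (G.vertexOf d)) 1 with hH
  have htail : ∑ e ∈ G.planar.vertexDarts d, G.tailRay (G.rot.symm e) =
      ∑ e ∈ G.planar.vertexDarts d, G.tailRay e :=
    Finset.sum_equiv G.rot.symm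
      (fun e => by simp only [G.planar.mem_vertexDarts, PlaneMap.vertexOf_rot_symm])
      fun _ _ => rfl
  have hjump : G.jump H = 0 := by
    simp only [hH, map_add, map_sum, hh.jump_eq hloop, jump_single_vertex,
      Finset.sum_sub_distrib, htail]
    abel
  have hvertex : H (.inl (G.vertexOf d)) = 1 := by
    rw [hH, Pi.add_apply, Finset.sum_apply, Pi.single_eq_same, Finset.sum_eq_zero, zero_add]
    exact fun e he => G.planar.mem_vertexDarts.1 he ▸ hh.vertexOf_eq_zero hadj e
  exact eq_sub_of_add_eq (funext fun q => (eq_of_jump_eq_zero hjump q _).trans hvertex)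

open Classical in
theorem sum_faceDarts (hh : G.IsEdgePotential h) (hloop : G.NoTrackLoops)
    (hadj : ∀ d, ¬G.SameTrack (G.rot.symm d) d) (d : D) (q : G.QuadVertex) :
    ∑ e ∈ G.planar.faceDarts d, h e q =
      ∑ e ∈ G.planar.faceDarts d, (if G.white e then 1 else 0) - 1 +
        Pi.single (M := fun _ => ℤ) (.inr (G.faceOf d)) 1 q := by
  set H := ∑ e ∈ G.planar.faceDarts d, h e - Pi.single (.inr (G.faceOf d)) 1 with hH
  have htail : ∑ e ∈ G.planar.faceDarts d, G.tailRay (G.rot.symm e) =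
      ∑ e ∈ G.planar.faceDarts d, G.tailRay e :=
    Finset.sum_equiv G.faceNext
      (fun e => by simp only [G.planar.mem_faceDarts, PlaneMap.faceOf_faceNext])
      fun e _ => tailRay_rot_symm e
  have hjump : G.jump H = 0 := by
    simp only [hH, map_sub, map_sum, hh.jump_eq hloop, jump_single_face,
      Finset.sum_sub_distrib, htail]
    abel
  have hface : H (.inr (G.faceOf d)) =
      ∑ e ∈ G.planar.faceDarts d, (if G.white e then 1 else 0) - 1 := by
    rw [hH, Pi.sub_apply, Finset.sum_apply, Pi.single_eq_same]
    congr 1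
    exact Finset.sum_congr rfl fun e he =>
      G.planar.mem_faceDarts.1 he ▸ hh.faceOf_eq hloop hadj e
  rw [← hface, ← eq_of_jump_eq_zero hjump q, hH, Pi.sub_apply, Finset.sum_apply, sub_add_cancel]

theorem sideOf_eq_zero (hh : G.IsEdgePotential h) (hloop : G.NoTrackLoops)
    (hadj : ∀ d, ¬G.SameTrack (G.rot.symm d) d) (b : Bool) (u : D) :
    h (G.exitEdge u) (G.sideOf b u) = 0 := by
  cases hu : G.white u
  · rw [exitEdge, hu, if_neg (by simp), hh.rev]
    cases b
    · simpa [sideOf, hu] using hh.vertexOf_eq_zero hadj u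
    · simpa [sideOf, hu] using hh.faceOf_eq hloop hadj u
  · rw [exitEdge, hu, if_pos rfl]
    cases b
    · have h := hh.faceOf_eq hloop hadj (G.rev (G.rot u))
      rw [hh.rev, ← PlaneMap.faceOf_faceNext, PlaneMap.faceNext_rev] at h
      simpa [sideOf, hu] using h
    · have h := hh.vertexOf_eq_zero hadj (G.rot u)
      rw [PlaneMap.vertexOf_rot] at h
      simpa [sideOf, hu] using h

theorem sideOf_nextStrand (hh : G.IsEdgePotential h)
    (hadj : ∀ d, ¬G.SameTrack (G.rot.symm d) d) (b : Bool) (u : D) :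
    h (G.exitEdge u) (G.sideOf b (G.nextStrand u)) = if G.white u = b then 1 else 0 := by
  cases hu : G.white u
  · have he : G.white (G.rev u) = true := by simp [hu]
    rw [exitEdge, hu, if_neg (by simp), nextStrand_of_black hu]
    cases b
    · simpa [sideOf, hu] using hh.faceOf_of_white hadj he
    · simpa [sideOf, hu] using hh.vertexOf_eq_zero hadj (G.rev u)
  · have he : G.white (G.rot u) = true := by simp [hu]
    rw [exitEdge, hu, if_pos rfl, nextStrand_of_white hu]
    cases b
    · have h := hh.vertexOf_eq_zero hadj (G.rev (G.rot u))
      rw [hh.rev, ← PlaneMap.vertexOf_faceNext] at h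
      simpa [sideOf, hu] using h
    · have h := hh.faceOf_of_white hadj he
      rw [← PlaneMap.faceOf_faceNext] at h
      simpa [sideOf, hu] using h

theorem jump_exitEdge (hh : G.IsEdgePotential h) {u u' : D} (huu' : G.Crosses u u') :
    G.jump (h (G.exitEdge u)) =
      G.colourSign u • (G.ray (G.nextStrand u) - G.ray (G.nextStrand u')) := by
  obtain ⟨e, he, hexit, ⟨rfl, rfl⟩ | ⟨rfl, rfl⟩⟩ := huu'.exists_dart <;>
    rw [hexit, hh.jump_of_white e he, nextStrand_rot_symm he, nextStrand_rev he] <;>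
    simp [colourSign, he]

end IsEdgePotential

end EdgePotential

end BipartitePlaneGraph

namespace PlaneMap.Disc

variable {D : Type*} {M : PlaneMap D} (B : M.Disc)

theorem bdry_mem_quads_iff {k : ℕ} (hk : k ≤ 2 * B.len) : B.bdry k ∈ B.quads ↔ Even k := by
  rcases k.even_or_odd' with ⟨i, rfl | rfl⟩
  · refine iff_of_true ?_ (even_two_mul i)
    rcases (Nat.le_of_mul_le_mul_left hk two_pos).lt_or_eq with hi | rfl
    · exact (B.left_even i hi).1
    · exact B.bdry_closed ▸ (B.left_even 0 B.len_pos).1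
  · exact iff_of_false (B.left_odd i (by omega)).2 (Nat.not_even_two_mul_add_one i)

theorem rot_bdry_mem_quads_iff {k : ℕ} (hk : k < 2 * B.len) :
    M.rot (B.bdry k) ∈ B.quads ↔ ¬Even k := by
  rcases k.even_or_odd' with ⟨i, rfl | rfl⟩
  · exact iff_of_false (B.left_even i (by omega)).2 (not_not.2 (even_two_mul i))
  · exact iff_of_true (B.left_odd i (by omega)).1 (Nat.not_even_two_mul_add_one i)

/-- The corners lying between two quadrilaterals of the disc. -/
def innerCorners : Set D := {u | u ∈ B.quads ∧ M.rot u ∈ B.quads}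

variable {B} in
theorem notMem_innerCorners_of_notMem_quads {u : D} (hu : u ∉ B.quads) : u ∉ B.innerCorners :=
  fun h => hu h.1

theorem bdry_notMem_innerCorners {k : ℕ} (hk : k < 2 * B.len) : B.bdry k ∉ B.innerCorners :=
  fun h => (B.rot_bdry_mem_quads_iff hk).1 h.2 ((B.bdry_mem_quads_iff hk.le).1 h.1)

theorem eq_bdry_even {i : ℕ} (hi : i < B.len) {d : D} (hv : M.SameVertex d (B.bdry (2 * i)))
    (hd : d ∈ B.quads) (hd' : M.rot d ∉ B.quads) : d = B.bdry (2 * i) := by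
  obtain ⟨j, hj, rfl⟩ := B.complete d (by tauto)
  obtain ⟨j, rfl⟩ := even_iff_exists_two_mul.1 ((B.bdry_mem_quads_iff hj.le).1 hd)
  rw [B.vertex_simple j (by omega) i hi hv]

theorem eq_bdry_odd {i : ℕ} (hi : i < B.len) {d : D} (hf : M.SameFace d (B.bdry (2 * i + 1)))
    (hd : d ∉ B.quads) (hd' : M.rot d ∈ B.quads) : d = B.bdry (2 * i + 1) := by
  obtain ⟨j, hj, rfl⟩ := B.complete d (by tauto)
  obtain ⟨j, rfl⟩ := Nat.not_even_iff_odd.1 ((B.rot_bdry_mem_quads_iff hj).1 hd')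
  rw [B.face_simple j (by omega) i hi hf]

theorem bdry_injOn : Set.InjOn B.bdry (Set.Iio (2 * B.len)) := by
  intro j hj k hk h
  rw [Set.mem_Iio] at hj hk
  have hparity : Even j ↔ Even k := by
    rw [← B.bdry_mem_quads_iff hj.le, ← B.bdry_mem_quads_iff hk.le, h]
  rcases j.even_or_odd' with ⟨i, rfl | rfl⟩ <;> rcases k.even_or_odd' with ⟨l, rfl | rfl⟩
  · rw [B.vertex_simple i (by omega) l (by omega) (h ▸ .refl _ _)]
  · simp at hparity
  · simp at hparity
  · rw [B.face_simple i (by omega) l (by omega) (h ▸ .refl _ _)]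

open scoped Classical in
/-- The dart, in the disc, of the edge adjacent to a corner of the boundary. -/
noncomputable def innerDart (k : ℕ) : D := if Even k then B.bdry k else M.rot (B.bdry k)

end PlaneMap.Disc

namespace BipartitePlaneGraph

open Filter

variable {D : Type*} {G : BipartitePlaneGraph D} (B : G.Disc)

section DiscClass

/-- The boundaries of the chains of strands inside a disc. -/
def innerBoundaries : AddSubgroup (D → ℤ) :=
  (AddSubgroup.pi B.innerCornersᶜ fun _ => ⊥).map G.boundary

/-- The class of an edge up to boundaries of chains inside a disc: two edges in the same class are
joined by a chain of strands inside the disc. -/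
noncomputable def discClass (d : D) : (D → ℤ) ⧸ innerBoundaries B :=
  QuotientAddGroup.mk (G.edgeClass d)

variable {B}

theorem discClass_rev (d : D) : discClass B (G.rev d) = discClass B d := by
  rw [discClass, discClass, edgeClass_rev]

theorem discClass_rot {d : D} (hd : d ∈ B.quads) (hd' : G.rot d ∈ B.quads) :
    discClass B (G.rot d) = discClass B d := by
  classical
  refine QuotientAddGroup.eq.2 ⟨G.colourSign d • Pi.single d 1, fun u hu => ?_, ?_⟩
  · have hne : u ≠ d := fun h => hu (h ▸ ⟨hd, hd'⟩)
    simp [hne]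
  · rw [map_zsmul, boundary_single, smul_smul, colourSign_mul_self, one_smul]
    abel

theorem discClass_eq_of_pow_rot {i : ℕ} (hi : i < B.len) (n : ℕ) {d : D} (hd : d ∈ B.quads)
    (h : (G.rot ^ n) d = B.bdry (2 * i)) : discClass B d = discClass B (B.bdry (2 * i)) := by
  induction n generalizing d with
  | zero => exact congrArg _ h
  | succ n ih =>
    by_cases hd' : G.rot d ∈ B.quads
    · rw [← discClass_rot hd hd', ih hd' (by rwa [pow_succ] at h)]
    · rw [B.eq_bdry_even hi ⟨(n + 1 : ℕ), h⟩ hd hd']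

theorem discClass_eq_of_pow_faceNext {i : ℕ} (hi : i < B.len) (n : ℕ) {d : D}
    (hd : d ∈ B.quads) (h : (G.faceNext ^ n) d = B.bdry (2 * i + 1)) :
    discClass B d = discClass B (G.rot (B.bdry (2 * i + 1))) := by
  induction n generalizing d with
  | zero => exact absurd (h ▸ hd) (B.left_odd i hi).2
  | succ n ih =>
    have hrot : G.rot (G.faceNext d) ∈ B.quads := by rwa [PlaneMap.rot_faceNext, B.rev_mem]
    by_cases hd' : G.faceNext d ∈ B.quads
    · rw [← ih hd' (by rwa [pow_succ] at h), ← discClass_rot hd' hrot, PlaneMap.rot_faceNext,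
        discClass_rev]
    · rw [← B.eq_bdry_odd hi ⟨n, by rwa [pow_succ] at h⟩ hd' hrot, PlaneMap.rot_faceNext,
        discClass_rev]

theorem discClass_innerDart_succ {k : ℕ} (hk : k < 2 * B.len) :
    discClass B (B.innerDart (k + 1)) = discClass B (B.innerDart k) := by
  rcases k.even_or_odd' with ⟨i, rfl | rfl⟩
  · have hi : i < B.len := by omega
    have hvertex : G.rot.SameCycle (G.rot (B.bdry (2 * i + 1))) (B.bdry (2 * i)) :=
      Equiv.Perm.sameCycle_apply_left.2 (B.vertex_step i hi).symm
    obtain ⟨n, -, hn⟩ := exists_pow_eq_of_finite_sameCycle (G.planar.vertex_finite _) hvertex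
    simpa [PlaneMap.Disc.innerDart] using discClass_eq_of_pow_rot hi n (B.left_odd i hi).1 hn
  · have hi : i < B.len := by omega
    obtain ⟨n, -, hn⟩ := exists_pow_eq_of_finite_sameCycle (G.planar.face_finite _)
      (B.face_step i hi).symm
    have hmem : B.bdry (2 * i + 2) ∈ B.quads := by
      rw [B.bdry_mem_quads_iff (by omega)]
      exact ⟨i + 1, by ring⟩
    simpa [PlaneMap.Disc.innerDart, add_assoc, Nat.even_add] using
      discClass_eq_of_pow_faceNext hi n hmem hn

theorem discClass_innerDart {k : ℕ} (hk : k ≤ 2 * B.len) :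
    discClass B (B.innerDart k) = discClass B (B.innerDart 0) := by
  induction k with
  | zero => rfl
  | succ k ih => rw [discClass_innerDart_succ hk, ih (Nat.le_of_succ_le hk)]

end DiscClass

/-- The vertices of the quad-graph on the boundary of a disc: the corner of index `k` goes from the
`k`-th one to the next one. -/
noncomputable def discVertex (k : ℕ) : G.QuadVertex :=
  if Even k then .inr (G.faceOf (B.bdry k)) else .inl (G.vertexOf (B.bdry k))

variable {B}

theorem discVertex_succ {k : ℕ} (hk : k < 2 * B.len) : discVertex B (k + 1) =
    if Even k then .inl (G.vertexOf (B.bdry k)) else .inr (G.faceOf (B.bdry k)) := by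
  rcases k.even_or_odd' with ⟨i, rfl | rfl⟩
  · simp [discVertex, PlaneMap.vertexOf_eq_iff.2 (B.vertex_step i (by omega))]
  · simp [discVertex, Nat.even_add, PlaneMap.faceOf_eq_iff.2 (B.face_step i (by omega))]

theorem jump_bdry_eq_zero {H : G.QuadVertex → ℤ} {k : ℕ} (hk : k < 2 * B.len)
    (hH : G.jump H (B.bdry k) = 0) : H (discVertex B (k + 1)) = H (discVertex B k) := by
  rw [jump_apply_eq_zero] at hH
  rw [discVertex_succ hk, discVertex]
  split_ifs
  exacts [hH, hH.symm]

theorem exitEdge_mem_quads_iff {u : D} :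
    G.exitEdge u ∈ B.quads ↔ if G.white u then G.rot u ∈ B.quads else u ∈ B.quads := by
  rw [exitEdge]
  split_ifs
  exacts [.rfl, B.rev_mem u]

theorem exitEdge_mem_quads_iff_nextStrand {u : D} : G.exitEdge u ∈ B.quads ↔
    if G.white u then G.rot (G.nextStrand u) ∈ B.quads else G.nextStrand u ∈ B.quads := by
  cases hu : G.white u
  · simp [exitEdge, hu, nextStrand_of_black hu]
  · simp [exitEdge, hu, nextStrand_of_white hu, PlaneMap.rot_faceNext, B.rev_mem]

theorem notMem_innerCorners {u : D} (hu : G.exitEdge u ∉ B.quads) : u ∉ B.innerCorners := by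
  rw [exitEdge_mem_quads_iff] at hu
  rintro ⟨h, h'⟩
  split_ifs at hu
  exacts [hu h', hu h]

theorem nextStrand_notMem_innerCorners {u : D} (hu : G.exitEdge u ∉ B.quads) :
    G.nextStrand u ∉ B.innerCorners := by
  rw [exitEdge_mem_quads_iff_nextStrand] at hu
  rintro ⟨h, h'⟩
  split_ifs at hu
  exacts [hu h', hu h]

theorem nextStrand_notMem_quads {u : D} (hu : G.exitEdge u ∉ B.quads)
    (hu' : G.exitEdge (G.nextStrand u) ∉ B.quads) :
    G.nextStrand u ∉ B.quads ∧ G.rot (G.nextStrand u) ∉ B.quads := by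
  rw [exitEdge_mem_quads_iff_nextStrand] at hu
  rw [exitEdge_mem_quads_iff, white_nextStrand] at hu'
  cases h : G.white u <;> simp_all

/-- Indices of boundary corners through which train-tracks leave a disc for the last time, the parts
of these train-tracks following the disc being disjoint. -/
structure IsExitSet (B : G.Disc) (E : Set ℕ) : Prop where
  lt : ∀ p ∈ E, p < 2 * B.len
  exitEdge_notMem : ∀ p ∈ E, ∀ n : ℕ, G.exitEdge ((G.nextStrand ^ n) (B.bdry p)) ∉ B.quads
  pairwise : E.Pairwise fun p q => ∀ m n : ℕ,
    G.exitEdge ((G.nextStrand ^ m) (B.bdry p)) ≠ G.exitEdge ((G.nextStrand ^ n) (B.bdry q))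

namespace IsExitSet

variable {E : Set ℕ} {p q r : ℕ}

theorem white_iff (hE : IsExitSet B E) (hp : p ∈ E) : G.white (B.bdry p) = true ↔ Even p := by
  have h := hE.exitEdge_notMem p hp 0
  rw [pow_zero, Equiv.Perm.one_apply, exitEdge_mem_quads_iff,
    B.rot_bdry_mem_quads_iff (hE.lt p hp), B.bdry_mem_quads_iff (hE.lt p hp).le] at h
  split_ifs at h with hw
  · exact iff_of_true hw (not_not.1 h)
  · exact iff_of_false hw h

theorem sideOf_false (hE : IsExitSet B E) (hp : p ∈ E) :
    G.sideOf false (B.bdry p) = discVertex B p := by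
  have hw := hE.white_iff hp
  by_cases hp' : Even p
  · simp [sideOf, discVertex, hp', hw.2 hp']
  · simp [sideOf, discVertex, hp', Bool.eq_false_iff.2 (mt hw.1 hp')]

theorem sideOf_true (hE : IsExitSet B E) (hp : p ∈ E) :
    G.sideOf true (B.bdry p) = discVertex B (p + 1) := by
  rw [sideOf, discVertex_succ (hE.lt p hp)]
  simp only [hE.white_iff hp]

theorem boundary_ray (hE : IsExitSet B E) (hloop : G.NoTrackLoops) (hp : p ∈ E) :
    G.boundary (G.ray (B.bdry p)) = G.edgeClass (B.innerDart p) := by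
  simp only [hloop.boundary_ray, hE.white_iff hp, PlaneMap.Disc.innerDart]

theorem ray_bdry (hE : IsExitSet B E) (hp : p ∈ E) {k : ℕ} (hk : k < 2 * B.len) :
    G.ray (B.bdry p) (B.bdry k) = if k = p then 1 else 0 := by
  split_ifs with h
  · rw [h, ray_self]
  · refine ray_eq_zero fun n hn => ?_
    rcases n with _ | n
    · exact h (B.bdry_injOn hk (hE.lt p hp) hn.symm)
    · have hout := hE.exitEdge_notMem p hp (n + 1)
      rw [pow_succ', Equiv.Perm.mul_apply] at hn hout
      have := nextStrand_notMem_quads (hE.exitEdge_notMem p hp n) hout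
      rw [hn, B.bdry_mem_quads_iff hk.le, B.rot_bdry_mem_quads_iff hk] at this
      exact this.2 this.1

theorem ray_eq_zero_of_crosses (hE : IsExitSet B E) (hadj : ∀ d, ¬G.SameTrack (G.rot.symm d) d)
    (hp : p ∈ E) (hq : q ∈ E) {n : ℕ} {u : D}
    (hu : G.Crosses ((G.nextStrand ^ n) (B.bdry p)) u) : G.ray (B.bdry q) u = 0 := by
  refine ray_eq_zero fun m hm => ?_
  obtain rfl | hpq := eq_or_ne p q
  · exact hu.not_sameTrack hadj ((SameTrack.pow _ n).symm.trans (hm ▸ SameTrack.pow _ m))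
  · exact hE.pairwise hp hq hpq n m (hm ▸ hu.2)

theorem ray_nextStrand_eq_zero_of_crosses (hE : IsExitSet B E) (hloop : G.NoTrackLoops)
    (hadj : ∀ d, ¬G.SameTrack (G.rot.symm d) d) (hp : p ∈ E) (hq : q ∈ E) {n : ℕ} {u : D}
    (hu : G.Crosses ((G.nextStrand ^ n) (B.bdry p)) u) :
    G.ray (B.bdry q) (G.nextStrand u) = 0 := by
  have hne : G.nextStrand u ≠ B.bdry q := by
    intro h
    have hout := hE.exitEdge_notMem p hp n
    have hwhite := hE.white_iff hq
    rw [hu.2, exitEdge_mem_quads_iff_nextStrand, h, B.rot_bdry_mem_quads_iff (hE.lt q hq),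
      B.bdry_mem_quads_iff (hE.lt q hq).le] at hout
    rw [← h, white_nextStrand] at hwhite
    cases hw : G.white u <;> simp_all [-Nat.not_even_iff_odd]
  have h := hloop.ray_nextStrand (B.bdry q) u
  rwa [hE.ray_eq_zero_of_crosses hadj hp hq hu, sub_zero, if_neg hne] at h

end IsExitSet

/-- The function jumps, outside the disc, across the parts of two train-tracks following their exits
from the disc: up to a constant, it is there the indicator function of the sector between them. -/
def IsSector (B : G.Disc) (p q : ℕ) (H : G.QuadVertex → ℤ) : Prop :=
  ∀ u ∉ B.innerCorners, G.jump H u = G.ray (B.bdry p) u - G.ray (B.bdry q) u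

theorem IsExitSet.exists_isSector {E : Set ℕ} {p q : ℕ} (hE : IsExitSet B E)
    (hloop : G.NoTrackLoops) (hp : p ∈ E) (hq : q ∈ E) (r : G.QuadVertex) :
    ∃ H, IsSector B p q H ∧ H r = 0 := by
  have hclass : discClass B (B.innerDart p) = discClass B (B.innerDart q) :=
    (discClass_innerDart (hE.lt p hp).le).trans (discClass_innerDart (hE.lt q hq).le).symm
  obtain ⟨Q, hQ, hboundary⟩ := QuotientAddGroup.eq.1 hclass
  have hcycle : G.boundary (G.ray (B.bdry p) - G.ray (B.bdry q) + Q) = 0 := by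
    rw [map_add, map_sub, hE.boundary_ray hloop hp, hE.boundary_ray hloop hq, hboundary]
    abel
  obtain ⟨H, hH, hr⟩ := exists_jump_eq hcycle r
  refine ⟨H, fun u hu => ?_, hr⟩
  rw [hH, Pi.add_apply, hQ u hu, add_zero, Pi.sub_apply]

theorem Crosses.apply_sideOf_nextStrand {u u' : D} (hu : G.Crosses u u') {H : G.QuadVertex → ℤ}
    (h : G.jump H u' = 0) (h' : G.jump H (G.nextStrand u') = 0) (b : Bool) :
    H (G.sideOf b (G.nextStrand u)) = H (G.sideOf b u) := by
  have heq {s : D} (hs : G.jump H s = 0) (c : Bool) :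
      H (G.sideOf (!c) s) = H (G.sideOf c s) := by
    rw [jump_apply_eq_sideOf, sub_eq_zero] at hs
    cases c
    exacts [hs, hs.symm]
  obtain rfl | rfl := b.eq_or_eq_not (G.white u)
  · rw [hu.sideOf_nextStrand, hu.sideOf_self, heq h']
  · rw [hu.sideOf_not, ← heq h, ← hu.white_right, hu.symm.sideOf_self]

namespace IsSector

variable {E : Set ℕ} {p q r : ℕ} {H : G.QuadVertex → ℤ}

theorem apply_discVertex (hH : IsSector B p q H) (hE : IsExitSet B E) (hp : p ∈ E) (hq : q ∈ E)
    {k : ℕ} (hk : k ≤ 2 * B.len) : H (discVertex B k) =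
      H (discVertex B 0) + (if p < k then 1 else 0) - if q < k then 1 else 0 := by
  induction k with
  | zero => simp
  | succ k ih =>
    have hjump := hH _ (B.bdry_notMem_innerCorners hk)
    rw [hE.ray_bdry hp hk, hE.ray_bdry hq hk] at hjump
    have hstep : H (discVertex B (k + 1)) - H (discVertex B k) =
        (if k = p then 1 else 0) - if k = q then 1 else 0 := by
      by_cases hkE : k ∈ E
      · rw [← hjump, jump_apply_eq_sideOf, hE.sideOf_true hkE, hE.sideOf_false hkE]
      · have hkp : k ≠ p := fun h => hkE (h ▸ hp)
        have hkq : k ≠ q := fun h => hkE (h ▸ hq)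
        rw [if_neg hkp, if_neg hkq, sub_self] at hjump ⊢
        rw [jump_bdry_eq_zero hk hjump, sub_self]
    have hsucc (x : ℕ) : (if x < k + 1 then (1 : ℤ) else 0) =
        (if x < k then 1 else 0) + if k = x then 1 else 0 := by
      split_ifs <;> omega
    rw [hsucc, hsucc]
    linear_combination hstep + ih (Nat.le_of_succ_le hk)

theorem apply_sideOf_pow (hH : IsSector B p q H) (hE : IsExitSet B E) (hloop : G.NoTrackLoops)
    (hadj : ∀ d, ¬G.SameTrack (G.rot.symm d) d) (hp : p ∈ E) (hq : q ∈ E) (hr : r ∈ E)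
    (b : Bool) (n : ℕ) :
    H (G.sideOf b ((G.nextStrand ^ n) (B.bdry r))) = H (G.sideOf b (B.bdry r)) := by
  induction n with
  | zero => rfl
  | succ n ih =>
    have hout := hE.exitEdge_notMem r hr n
    obtain ⟨u, hu⟩ := exists_crosses ((G.nextStrand ^ n) (B.bdry r))
    rw [pow_succ', Equiv.Perm.mul_apply, ← ih]
    rw [hu.2] at hout
    refine hu.apply_sideOf_nextStrand ?_ ?_ b
    · rw [hH u (notMem_innerCorners hout), hE.ray_eq_zero_of_crosses hadj hr hp hu,
        hE.ray_eq_zero_of_crosses hadj hr hq hu, sub_zero]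
    · rw [hH _ (nextStrand_notMem_innerCorners hout),
        hE.ray_nextStrand_eq_zero_of_crosses hloop hadj hr hp hu,
        hE.ray_nextStrand_eq_zero_of_crosses hloop hadj hr hq hu, sub_zero]

theorem jump_eventuallyEq (hH : IsSector B p q H) (hloop : G.NoTrackLoops) {s t : D}
    (hs : G.SameTrack s (B.bdry p)) (ht : G.SameTrack t (B.bdry q)) :
    G.jump H =ᶠ[cofinite] G.ray s - G.ray t := by
  filter_upwards [hloop.ray_eventuallyEq hs, hloop.ray_eventuallyEq ht,
    B.quads_finite.compl_mem_cofinite] with u hsu htu hu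
  rw [hH u (PlaneMap.Disc.notMem_innerCorners_of_notMem_quads hu), Pi.sub_apply, hsu, htu]

theorem sideOf_eq (hH : IsSector B p q H) {s : D} (hs : s ∉ B.quads)
    (hp : ∀ n : ℕ, (G.nextStrand ^ n) (B.bdry p) ≠ s)
    (hq : ∀ n : ℕ, (G.nextStrand ^ n) (B.bdry q) ≠ s) :
    H (G.sideOf true s) = H (G.sideOf false s) := by
  rw [← sub_eq_zero, ← jump_apply_eq_sideOf,
    hH s (PlaneMap.Disc.notMem_innerCorners_of_notMem_quads hs), ray_eq_zero hp, ray_eq_zero hq,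
    sub_zero]

end IsSector

theorem eventually_of_frequently {P : G.QuadVertex → Prop}
    (hP : ∀ᶠ s in cofinite, P (G.sideOf true s) ↔ P (G.sideOf false s))
    (hfreq : ∃ᶠ q in cofinite, P q) : ∀ᶠ q in cofinite, P q := by
  classical
  obtain ⟨c, hc⟩ := exists_eventually_eq_const (H := fun q => if P q then 1 else 0) <| by
    filter_upwards [hP] with s hs
    simp [jump_apply_eq_sideOf, hs]
  obtain ⟨q, hq, hqc⟩ := (hfreq.and_eventually hc).exists
  refine hc.mono fun r hr => ?_
  rw [← hqc, if_pos hq] at hr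
  exact of_not_not fun h => zero_ne_one ((if_neg h).symm.trans hr)

end BipartitePlaneGraph

/-- Up to finitely many points, the function takes its values in the set, each of them infinitely
often. -/
def HasLimitValues {Q A : Type*} (f : Q → A) (S : Set A) : Prop :=
  (∀ᶠ q in Filter.cofinite, f q ∈ S) ∧ ∀ a ∈ S, ∃ᶠ q in Filter.cofinite, f q = a

namespace BipartitePlaneGraph

open Filter

variable {D : Type*} {G : BipartitePlaneGraph D} {B : G.Disc}

theorem IsExitSet.hasLimitValues {E : Set ℕ} (hE : IsExitSet B E) (hloop : G.NoTrackLoops)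
    {A : Type*} {f : G.QuadVertex → A} {S : Set A} (hS : S.Nonempty)
    (hray : ∀ r ∈ E, ∀ b, ∀ n : ℕ,
      f (G.sideOf b ((G.nextStrand ^ n) (B.bdry r))) = f (G.sideOf b (B.bdry r)))
    (houter : ∀ s ∉ B.quads, (∀ r ∈ E, ∀ n : ℕ, (G.nextStrand ^ n) (B.bdry r) ≠ s) →
      f (G.sideOf true s) = f (G.sideOf false s))
    (hmem : ∀ r ∈ E, f (discVertex B r) ∈ S ∧ f (discVertex B (r + 1)) ∈ S)
    (hsurj : ∀ a ∈ S, ∃ r ∈ E, f (discVertex B (r + 1)) = a) : HasLimitValues f S := by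
  have hside {r : ℕ} (hr : r ∈ E) (b : Bool) (n : ℕ) :
      f (G.sideOf b ((G.nextStrand ^ n) (B.bdry r))) ∈ S := by
    rw [hray r hr]
    cases b
    exacts [hE.sideOf_false hr ▸ (hmem r hr).1, hE.sideOf_true hr ▸ (hmem r hr).2]
  have hfreq (a) (ha : a ∈ S) : ∃ᶠ q in cofinite, f q = a := by
    obtain ⟨r, hr, rfl⟩ := hsurj a ha
    refine ((tendsto_sideOf true).comp (hloop.tendsto_pow (B.bdry r))).frequently
      (Frequently.of_forall fun n => ?_)
    rw [Function.comp_apply, hray r hr, hE.sideOf_true hr]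
  refine ⟨eventually_of_frequently ?_ ?_, hfreq⟩
  · filter_upwards [B.quads_finite.compl_mem_cofinite] with s hs
    by_cases hs' : ∀ r ∈ E, ∀ n : ℕ, (G.nextStrand ^ n) (B.bdry r) ≠ s
    · rw [houter s hs hs']
    · push Not at hs'
      obtain ⟨r, hr, n, rfl⟩ := hs'
      exact iff_of_true (hside hr true n) (hside hr false n)
  · obtain ⟨a, ha⟩ := hS
    exact (hfreq a ha).mono fun q hq => hq ▸ ha

theorem IsExitSet.exists_hasLimitValues {p₁ p₂ p₃ : ℕ} (hE : IsExitSet B {p₁, p₂, p₃})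
    (hloop : G.NoTrackLoops) (hadj : ∀ d, ¬G.SameTrack (G.rot.symm d) d)
    (hord : (p₁ < p₂ ∧ p₂ < p₃) ∨ (p₂ < p₃ ∧ p₃ < p₁) ∨ (p₃ < p₁ ∧ p₁ < p₂)) :
    ∃ H₁ H₂, IsSector B p₁ p₂ H₁ ∧ IsSector B p₂ p₃ H₂ ∧
      HasLimitValues (fun q => (H₁ q, H₂ q)) {(0, 0), (1, 0), (0, 1)} := by
  set E : Set ℕ := {p₁, p₂, p₃} with hEdef
  have hp₁ : p₁ ∈ E := by simp [hEdef]
  have hp₂ : p₂ ∈ E := by simp [hEdef]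
  have hp₃ : p₃ ∈ E := by simp [hEdef]
  obtain ⟨H₁, hH₁, hbase₁⟩ := hE.exists_isSector hloop hp₁ hp₂ (discVertex B (p₃ + 1))
  obtain ⟨H₂, hH₂, hbase₂⟩ := hE.exists_isSector hloop hp₂ hp₃ (discVertex B (p₃ + 1))
  have hval₁ {k : ℕ} (hk : k ≤ 2 * B.len) : H₁ (discVertex B k) = (if p₁ < k then 1 else 0) -
      (if p₂ < k then 1 else 0) - (if p₁ < p₃ + 1 then 1 else 0) +
      if p₂ < p₃ + 1 then 1 else 0 := by
    linear_combination hH₁.apply_discVertex hE hp₁ hp₂ hk -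
      hH₁.apply_discVertex hE hp₁ hp₂ (hE.lt p₃ hp₃) + hbase₁
  have hval₂ {k : ℕ} (hk : k ≤ 2 * B.len) : H₂ (discVertex B k) = (if p₂ < k then 1 else 0) -
      (if p₃ < k then 1 else 0) - (if p₂ < p₃ + 1 then 1 else 0) + 1 := by
    have h := hH₂.apply_discVertex hE hp₂ hp₃ (hE.lt p₃ hp₃)
    rw [if_pos p₃.lt_succ_self] at h
    linear_combination hH₂.apply_discVertex hE hp₂ hp₃ hk - h + hbase₂
  refine ⟨H₁, H₂, hH₁, hH₂, hE.hasLimitValues hloop (Set.insert_nonempty _ _)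
    (fun r hr b n => Prod.ext (hH₁.apply_sideOf_pow hE hloop hadj hp₁ hp₂ hr b n)
      (hH₂.apply_sideOf_pow hE hloop hadj hp₂ hp₃ hr b n))
    (fun s hs hs' => Prod.ext (hH₁.sideOf_eq hs (hs' p₁ hp₁) (hs' p₂ hp₂))
      (hH₂.sideOf_eq hs (hs' p₂ hp₂) (hs' p₃ hp₃)))
    (fun r hr => ?_) ?_⟩
  · have hlt := hE.lt r hr
    simp only [Set.mem_insert_iff, Set.mem_singleton_iff, Prod.mk.injEq, hval₁ hlt, hval₂ hlt,
      hval₁ hlt.le, hval₂ hlt.le]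
    constructor <;> split_ifs <;> omega
  · simp only [Set.forall_mem_insert, Set.mem_singleton_iff, forall_eq, Prod.mk.injEq]
    refine ⟨⟨p₃, hp₃, hbase₁, hbase₂⟩, ⟨p₁, hp₁, ?_⟩, ⟨p₂, hp₂, ?_⟩⟩ <;>
      rw [hval₁ (hE.lt _ ‹_›), hval₂ (hE.lt _ ‹_›)] <;> split_ifs <;> omega

theorem GlobalOrder.exists_hasLimitValues (hloop : G.NoTrackLoops)
    (hadj : ∀ d, ¬G.SameTrack (G.rot.symm d) d) {a b c : D} (h : G.GlobalOrder a b c) :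
    ∃ H₁ H₂ : G.QuadVertex → ℤ, G.jump H₁ =ᶠ[cofinite] G.ray a - G.ray b ∧
      G.jump H₂ =ᶠ[cofinite] G.ray b - G.ray c ∧
      HasLimitValues (fun q => (H₁ q, H₂ q)) {(0, 0), (1, 0), (0, 1)} := by
  obtain ⟨-, -, B, p₁, p₂, p₃, ha, hb, hc, hab, hbc, hac, hord⟩ := h
  have hE : IsExitSet B {p₁, p₂, p₃} := by
    refine ⟨?_, ?_, ?_⟩
    · simp [ha.1, hb.1, hc.1]
    · simp [ha.2.2, hb.2.2, hc.2.2]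
    · simp only [Set.Pairwise, Set.mem_insert_iff, Set.mem_singleton_iff]
      rintro p (rfl | rfl | rfl) q (rfl | rfl | rfl) hpq m n
      exacts [absurd rfl hpq, hab.2 m n, hac.2 m n, (hab.2 n m).symm, absurd rfl hpq,
        hbc.2 m n, (hac.2 n m).symm, (hbc.2 n m).symm, absurd rfl hpq]
  obtain ⟨H₁, H₂, hH₁, hH₂, hlimit⟩ := hE.exists_hasLimitValues hloop hadj hord
  exact ⟨H₁, H₂, hH₁.jump_eventuallyEq hloop ha.2.1 hb.2.1,
    hH₂.jump_eventuallyEq hloop hb.2.1 hc.2.1, hlimit⟩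

end BipartitePlaneGraph

namespace HasLimitValues

open Filter

variable {Q A C : Type*} {f g : Q → A} {S T : Set A}

theorem comp (h : HasLimitValues f S) (g : A → C) : HasLimitValues (fun q => g (f q)) (g '' S) :=
  ⟨h.1.mono fun _ => Set.mem_image_of_mem g, by
    rintro _ ⟨a, ha, rfl⟩
    exact (h.2 a ha).mono fun _ => congrArg g⟩

theorem congr (h : HasLimitValues f S) (hfg : f =ᶠ[cofinite] g) : HasLimitValues g S :=
  ⟨(h.1.and hfg).mono fun _ hq => hq.2 ▸ hq.1,
    fun a ha => ((h.2 a ha).and_eventually hfg).mono fun _ hq => hq.2.symm.trans hq.1⟩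

theorem subset (h : HasLimitValues f S) (h' : HasLimitValues f T) : S ⊆ T := fun a ha => by
  obtain ⟨q, rfl, hq⟩ := ((h.2 a ha).and_eventually h'.1).exists
  exact hq

end HasLimitValues

/-- Up to finitely many points, the function takes two consecutive values, the smaller of which is
the given one, both of them infinitely often. -/
def HasLevel {Q : Type*} (H : Q → ℤ) (n : ℤ) : Prop := HasLimitValues H {n, n + 1}

namespace HasLevel

open Filter

variable {Q : Type*} {H K : Q → ℤ} {n m : ℤ}

theorem eventually (h : HasLevel H n) : ∀ᶠ q in cofinite, n ≤ H q ∧ H q ≤ n + 1 :=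
  h.1.mono fun q hq => by
    simp only [Set.mem_insert_iff, Set.mem_singleton_iff] at hq
    omega

theorem frequently_eq_add_one (h : HasLevel H n) : ∃ᶠ q in cofinite, H q = n + 1 :=
  h.2 _ (by simp)

theorem unique (h : HasLevel H n) (h' : HasLevel H m) : n = m := by
  have hn := h.subset h'
  have hm := h'.subset h
  simp only [Set.insert_subset_iff, Set.singleton_subset_iff, Set.mem_insert_iff,
    Set.mem_singleton_iff] at hn hm
  omega

theorem of_add_eventually_eq (h : HasLevel H n) {c : ℤ}
    (hK : ∀ᶠ q in cofinite, H q + K q = c) : HasLevel K (c - 1 - n) := by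
  have hsub : HasLimitValues (fun q => c - H q) {c - 1 - n, c - 1 - n + 1} := by
    convert h.comp (c - ·) using 1
    rw [Set.image_pair, Set.pair_comm, sub_add_eq_sub_sub, sub_right_comm, sub_add_cancel]
  exact hsub.congr (hK.mono fun q hq => sub_eq_of_eq_add' hq.symm)

end HasLevel

namespace BipartitePlaneGraph

open Filter

variable {D : Type*} {G : BipartitePlaneGraph D}

theorem exists_eventually_eq_add {H K : G.QuadVertex → ℤ}
    (h : G.jump H =ᶠ[cofinite] G.jump K) : ∃ c, ∀ᶠ q in cofinite, H q = K q + c := by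
  obtain ⟨c, hc⟩ := exists_eventually_eq_const (H := H - K) <| by
    filter_upwards [h] with u hu
    rw [map_sub, Pi.sub_apply, hu, sub_self, Pi.zero_apply]
  exact ⟨c, hc.mono fun q hq => by rw [← hq, Pi.sub_apply, add_sub_cancel]⟩

theorem sum_faceDarts_faceNext (φ : D → ℤ) (d : D) :
    ∑ e ∈ G.planar.faceDarts d, φ (G.faceNext e) = ∑ e ∈ G.planar.faceDarts d, φ e :=
  Finset.sum_equiv G.faceNext
    (fun e => by simp only [G.planar.mem_faceDarts, PlaneMap.faceOf_faceNext]) fun _ _ => rfl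

theorem sum_faceDarts_white_eq (b : Bool) (d : D) :
    ∑ e ∈ G.planar.faceDarts d, (if G.white e then (1 : ℤ) else 0) =
      ∑ e ∈ G.planar.faceDarts d, if G.white e = b then 1 else 0 := by
  cases b
  · rw [← sum_faceDarts_faceNext]
    simp [white_faceNext]
  · rfl

theorem sum_faceDarts_eq_sum_corners (b : Bool) {φ : D → ℤ} (hφ : ∀ e, φ (G.rev e) = φ e)
    (d : D) : ∑ e ∈ G.planar.faceDarts d, φ e =
      ∑ e ∈ G.planar.faceDarts d with G.white e = b, (φ e + φ (G.rot e)) := by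
  have hshift : ∑ e ∈ G.planar.faceDarts d with G.white e = b, φ (G.rot e) =
      ∑ e ∈ G.planar.faceDarts d with ¬G.white e = b, φ e := by
    rw [Finset.sum_filter, Finset.sum_filter, ← sum_faceDarts_faceNext]
    refine Finset.sum_congr rfl fun e _ => ?_
    rw [white_faceNext, PlaneMap.rot_faceNext, hφ]
    cases b <;> cases G.white e <;> rfl
  rw [Finset.sum_add_distrib, hshift, Finset.sum_filter_add_sum_filter_not]

namespace IsEdgePotential

variable {h : D → G.QuadVertex → ℤ}

theorem jump_eventuallyEq (hh : G.IsEdgePotential h) (hloop : G.NoTrackLoops) (d : D) :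
    G.jump (h d) =ᶠ[cofinite] G.ray (G.rot.symm d) - G.ray d := by
  cases hd : G.white d
  · rw [← hh.rev, hh.jump_of_white _ (by simp [hd]), PlaneMap.faceNext_rev]
    exact (EventuallyEq.refl _ _).sub (hloop.ray_eventuallyEq (sameTrack_rev d).symm)
  · rw [hh.jump_of_white d hd]
    exact (hloop.ray_eventuallyEq (sameTrack_rot_symm_faceNext d).symm).sub (EventuallyEq.refl _ _)

theorem exists_hasLimitValues (hh : G.IsEdgePotential h) (hloop : G.NoTrackLoops)
    (hadj : ∀ d, ¬G.SameTrack (G.rot.symm d) d) {d : D}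
    (horder : G.GlobalOrder (G.rot.symm d) d (G.rot d)) :
    ∃ n m, HasLimitValues (fun q => (h d q, h (G.rot d) q)) {(n, m), (n + 1, m), (n, m + 1)} := by
  obtain ⟨H₁, H₂, hH₁, hH₂, hvalues⟩ := horder.exists_hasLimitValues hloop hadj
  have hrot := hh.jump_eventuallyEq hloop (G.rot d)
  rw [Equiv.symm_apply_apply] at hrot
  obtain ⟨n, hn⟩ := exists_eventually_eq_add ((hh.jump_eventuallyEq hloop d).trans hH₁.symm)
  obtain ⟨m, hm⟩ := exists_eventually_eq_add (hrot.trans hH₂.symm)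
  refine ⟨n, m, ?_⟩
  have hshift := hvalues.comp fun a : ℤ × ℤ => (a.1 + n, a.2 + m)
  simp only [Set.image_insert_eq, Set.image_singleton, zero_add, add_comm (1 : ℤ)] at hshift
  exact hshift.congr (by filter_upwards [hn, hm] with q hnq hmq; rw [hnq, hmq])

theorem exists_hasLevel_pair (hh : G.IsEdgePotential h) (hloop : G.NoTrackLoops)
    (hadj : ∀ d, ¬G.SameTrack (G.rot.symm d) d) {d : D}
    (horder : G.GlobalOrder (G.rot.symm d) d (G.rot d)) :
    ∃ n m, HasLevel (h d) n ∧ HasLevel (h (G.rot d)) m ∧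
      HasLevel (fun q => h d q + h (G.rot d) q) (n + m) := by
  obtain ⟨n, m, hvalues⟩ := hh.exists_hasLimitValues hloop hadj horder
  refine ⟨n, m, ?_, ?_, ?_⟩
  · simpa [HasLevel, Set.image_insert_eq, Set.pair_comm] using hvalues.comp Prod.fst
  · simpa [HasLevel, Set.image_insert_eq] using hvalues.comp Prod.snd
  · simpa [HasLevel, Set.image_insert_eq, add_right_comm, ← add_assoc] using
      hvalues.comp fun a => a.1 + a.2

theorem eventually_add_rot (hh : G.IsEdgePotential h) (hloop : G.NoTrackLoops)
    (hadj : ∀ d, ¬G.SameTrack (G.rot.symm d) d) {d : D} (hd : G.rot (G.rot d) = d) :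
    ∀ᶠ q in cofinite, h d q + h (G.rot d) q = 1 := by
  classical
  have hne : d ≠ G.rot d := fun hd' => hadj d (by
    rw [G.rot.symm_apply_eq.2 hd']
    exact Equiv.Perm.SameCycle.refl _ _)
  have hdarts : G.planar.vertexDarts d = {d, G.rot d} := by
    ext e
    rw [G.planar.mem_vertexDarts, Finset.mem_insert, Finset.mem_singleton]
    refine ⟨fun he => ?_, ?_⟩
    · have hinv (y : D) : (G.rot y = d ∨ G.rot y = G.rot d) = (y = d ∨ y = G.rot d) := by
        rw [G.rot.injective.eq_iff, or_comm, ← G.rot.injective.eq_iff (b := G.rot d), hd]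
      exact (apply_eq_of_sameCycle (g := fun y => y = d ∨ y = G.rot d) hinv
        (PlaneMap.vertexOf_eq_iff.1 he)).mpr (.inl rfl)
    · rintro (rfl | rfl)
      exacts [rfl, PlaneMap.vertexOf_rot _]
  filter_upwards [eventually_cofinite_ne (.inl (G.vertexOf d) : G.QuadVertex)] with q hq
  have hsum := congrFun (hh.sum_vertexDarts hloop hadj d) q
  rwa [hdarts, Finset.sum_pair hne, Pi.sub_apply, Pi.single_eq_of_ne hq, sub_zero] at hsum

theorem exists_hasLevel (hh : G.IsEdgePotential h) (hloop : G.NoTrackLoops)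
    (hadj : ∀ d, ¬G.SameTrack (G.rot.symm d) d)
    (horder : ∀ d, G.rot (G.rot d) ≠ d → G.GlobalOrder (G.rot.symm d) d (G.rot d))
    (hface : ∀ d, ∃ e, G.SameFace d e ∧ G.rot (G.rot e) ≠ e) (d : D) :
    ∃ n, HasLevel (h d) n := by
  have hrot (d : D) : (∃ n, HasLevel (h (G.rot d)) n) ↔ ∃ n, HasLevel (h d) n := by
    by_cases hd : G.rot (G.rot d) = d
    · have hadd := hh.eventually_add_rot hloop hadj hd
      constructor
      · rintro ⟨n, hn⟩
        exact ⟨_, hn.of_add_eventually_eq (by simpa only [add_comm] using hadd)⟩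
      · rintro ⟨n, hn⟩
        exact ⟨_, hn.of_add_eventually_eq hadd⟩
    · obtain ⟨n, m, hn, hm, -⟩ := hh.exists_hasLevel_pair hloop hadj (horder d hd)
      exact iff_of_true ⟨m, hm⟩ ⟨n, hn⟩
  have hfaceNext (d : D) : (∃ n, HasLevel (h (G.faceNext d)) n) = ∃ n, HasLevel (h d) n := by
    rw [← hrot, PlaneMap.rot_faceNext, hh.rev]
  obtain ⟨e, he, he'⟩ := hface d
  obtain ⟨n, -, hn, -⟩ := hh.exists_hasLevel_pair hloop hadj (horder e he')
  exact (apply_eq_of_sameCycle (g := fun d => ∃ n, HasLevel (h d) n) hfaceNext he).mpr ⟨n, hn⟩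

variable {n : D → ℤ}

theorem level_rev (hh : G.IsEdgePotential h) (hn : ∀ d, HasLevel (h d) (n d)) (d : D) :
    n (G.rev d) = n d :=
  HasLevel.unique (hn (G.rev d)) (by rw [hh.rev]; exact hn d)

theorem hasLevel_add_rot (hh : G.IsEdgePotential h) (hloop : G.NoTrackLoops)
    (hadj : ∀ d, ¬G.SameTrack (G.rot.symm d) d) (hn : ∀ d, HasLevel (h d) (n d)) {d : D}
    (horder : G.GlobalOrder (G.rot.symm d) d (G.rot d)) :
    HasLevel (fun q => h d q + h (G.rot d) q) (n d + n (G.rot d)) := by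
  obtain ⟨k, m, hk, hm, hadd⟩ := hh.exists_hasLevel_pair hloop hadj horder
  rwa [(hn d).unique hk, (hn (G.rot d)).unique hm]

theorem eventually_add_rot_le (hh : G.IsEdgePotential h) (hloop : G.NoTrackLoops)
    (hadj : ∀ d, ¬G.SameTrack (G.rot.symm d) d)
    (horder : ∀ d, G.rot (G.rot d) ≠ d → G.GlobalOrder (G.rot.symm d) d (G.rot d))
    (hn : ∀ d, HasLevel (h d) (n d)) (d : D) :
    ∀ᶠ q in cofinite, h d q + h (G.rot d) q ≤ n d + n (G.rot d) + 1 := by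
  by_cases hd : G.rot (G.rot d) = d
  · have hadd := hh.eventually_add_rot hloop hadj hd
    have hlevel := (hn (G.rot d)).unique ((hn d).of_add_eventually_eq hadd)
    exact hadd.mono fun q hq => by omega
  · exact (hh.hasLevel_add_rot hloop hadj hn (horder d hd)).eventually.mono fun q hq => hq.2

theorem sum_level_vertexDarts_nonpos (hh : G.IsEdgePotential h) (hloop : G.NoTrackLoops)
    (hadj : ∀ d, ¬G.SameTrack (G.rot.symm d) d) (hn : ∀ d, HasLevel (h d) (n d)) (d : D) :
    ∑ e ∈ G.planar.vertexDarts d, n e ≤ 0 := by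
  classical
  have hle : ∀ᶠ q in cofinite, ∀ e ∈ G.planar.vertexDarts d, n e ≤ h e q :=
    (eventually_all_finset _).2 fun e _ => (hn e).eventually.mono fun q hq => hq.1
  obtain ⟨q, hq, hqle, hqne⟩ := ((hn d).frequently_eq_add_one.and_eventually
    (hle.and (eventually_cofinite_ne (.inl (G.vertexOf d) : G.QuadVertex)))).exists
  have hsum := congrFun (hh.sum_vertexDarts hloop hadj d) q
  rw [Finset.sum_apply, Pi.sub_apply, Pi.single_eq_of_ne hqne, sub_zero, Pi.one_apply] at hsum
  have hlt : ∑ e ∈ G.planar.vertexDarts d, n e < ∑ e ∈ G.planar.vertexDarts d, h e q :=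
    Finset.sum_lt_sum hqle ⟨d, G.planar.mem_vertexDarts.2 rfl, by omega⟩
  omega

theorem sum_level_faceDarts_nonneg (hh : G.IsEdgePotential h) (hloop : G.NoTrackLoops)
    (hadj : ∀ d, ¬G.SameTrack (G.rot.symm d) d)
    (horder : ∀ d, G.rot (G.rot d) ≠ d → G.GlobalOrder (G.rot.symm d) d (G.rot d))
    (hface : ∀ d, ∃ e, G.SameFace d e ∧ G.rot (G.rot e) ≠ e)
    (hn : ∀ d, HasLevel (h d) (n d)) (d : D) :
    0 ≤ ∑ e ∈ G.planar.faceDarts d, n e := by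
  classical
  obtain ⟨x, hdx, hx⟩ := hface d
  set S := {e ∈ G.planar.faceDarts d | G.white e = G.white x} with hS
  have hxS : x ∈ S := Finset.mem_filter.2
    ⟨G.planar.mem_faceDarts.2 (PlaneMap.faceOf_eq_iff.2 hdx).symm, rfl⟩
  have hle : ∀ᶠ q in cofinite, ∀ e ∈ S, h e q + h (G.rot e) q ≤ n e + n (G.rot e) + 1 :=
    (eventually_all_finset _).2 fun e _ => hh.eventually_add_rot_le hloop hadj horder hn e
  have hfreq : ∃ᶠ q in cofinite, h x q + h (G.rot x) q = n x + n (G.rot x) :=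
    (hh.hasLevel_add_rot hloop hadj hn (horder x hx)).2 _ (.inl rfl)
  obtain ⟨q, hq, hqle, hqne⟩ := (hfreq.and_eventually
    (hle.and (eventually_cofinite_ne (.inr (G.faceOf d) : G.QuadVertex)))).exists
  have hsum := hh.sum_faceDarts hloop hadj d q
  rw [Pi.single_eq_of_ne hqne, add_zero, sum_faceDarts_white_eq (G.white x), ← Finset.sum_filter,
    ← hS, sum_faceDarts_eq_sum_corners (G.white x) fun e => congrFun (hh.rev e) q] at hsum
  have hlt : ∑ e ∈ S, (h e q + h (G.rot e) q) < ∑ e ∈ S, (n e + n (G.rot e) + 1) :=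
    Finset.sum_lt_sum hqle ⟨x, hxS, by omega⟩
  rw [hsum, Finset.sum_add_distrib, ← sum_faceDarts_eq_sum_corners _ (hh.level_rev hn)] at hlt
  omega

end IsEdgePotential

theorem SameTrack.eq_of_exitEdge_eq (hadj : ∀ d, ¬G.SameTrack (G.rot.symm d) d) {u u' : D}
    (h : G.SameTrack u u') (hexit : G.exitEdge u = G.exitEdge u') : u = u' :=
  by_contra fun hne => Crosses.not_sameTrack hadj ⟨hne, hexit⟩ h

theorem NoTrackLoops.eq_of_exitEdge_pow_eq (hloop : G.NoTrackLoops)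
    (hadj : ∀ d, ¬G.SameTrack (G.rot.symm d) d) {s : D} {i j : ℕ}
    (h : G.exitEdge ((G.nextStrand ^ i) s) = G.exitEdge ((G.nextStrand ^ j) s)) : i = j :=
  hloop.pow_injective s <|
    SameTrack.eq_of_exitEdge_eq hadj ((SameTrack.pow s i).symm.trans (SameTrack.pow s j)) h

section Segment

variable (G) in
open Classical in
/-- The indicator function of the `n` strands following `s` on its train-track, without `s`. -/
noncomputable def segment (s : D) (n : ℕ) : D → ℤ :=
  ∑ i ∈ Finset.range n, Pi.single ((G.nextStrand ^ (i + 1)) s) 1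

variable {s : D} {n : ℕ}

theorem segment_eq_zero {u : D} (h : ∀ i < n, (G.nextStrand ^ (i + 1)) s ≠ u) :
    G.segment s n u = 0 := by
  classical
  rw [segment, Finset.sum_apply]
  exact Finset.sum_eq_zero fun i hi => Pi.single_eq_of_ne (h i (Finset.mem_range.1 hi)).symm _

theorem segment_eq_zero_of_not_sameTrack {u : D} (h : ¬G.SameTrack s u) : G.segment s n u = 0 :=
  segment_eq_zero fun i _ hi => h (hi ▸ SameTrack.pow s (i + 1))

theorem NoTrackLoops.ray_sub_ray_pow (hloop : G.NoTrackLoops) (s : D) (n : ℕ) :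
    G.ray (G.nextStrand s) - G.ray (G.nextStrand ((G.nextStrand ^ n) s)) = G.segment s n := by
  classical
  induction n with
  | zero => simp [segment]
  | succ n ih =>
    rw [segment, Finset.sum_range_succ, ← segment, ← ih, pow_succ', Equiv.Perm.mul_apply,
      hloop.ray_eq_single_add (G.nextStrand ((G.nextStrand ^ n) s))]
    abel

theorem NoTrackLoops.segment_nextStrand (hloop : G.NoTrackLoops) (s : D) (hn : 0 < n) :
    G.segment s n (G.nextStrand s) = 1 := by
  rw [← hloop.ray_sub_ray_pow, Pi.sub_apply, ray_self, ray_eq_zero fun k hk => ?_, sub_zero]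
  have hpow : (G.nextStrand ^ (k + (1 + n))) s = (G.nextStrand ^ 1) s := by
    simpa only [pow_add, pow_one, Equiv.Perm.mul_apply] using hk
  have := hloop.pow_injective s hpow
  omega

theorem sum_mul_segment (w : D → ℤ) {Δ : Finset D}
    (hΔ : ∀ i < n, (G.nextStrand ^ (i + 1)) s ∈ Δ) :
    ∑ d ∈ Δ, w d * G.segment s n d = ∑ i ∈ Finset.range n, w ((G.nextStrand ^ (i + 1)) s) := by
  classical
  simp only [segment, Finset.sum_apply, Finset.mul_sum]
  rw [Finset.sum_comm]
  exact Finset.sum_congr rfl fun i hi => by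
    simp [Pi.single_apply, hΔ i (Finset.mem_range.1 hi)]

theorem colourSign_mul_nextStrand {c : D → ℤ} (hc : ∀ d, c (G.rev d) = c d) (u : D) :
    G.colourSign (G.nextStrand u) * c (G.nextStrand u) =
      (if G.white u then 0 else c (G.exitEdge u)) -
        if G.white (G.nextStrand u) then 0 else c (G.exitEdge (G.nextStrand u)) := by
  cases hu : G.white u
  · simp [colourSign, exitEdge, hu, nextStrand_of_black hu]
  · simp [colourSign, exitEdge, hu, hc]

theorem sum_colourSign_mul_segment {c : D → ℤ} (hc : ∀ d, c (G.rev d) = c d) {Δ : Finset D}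
    (hΔ : ∀ i < n, (G.nextStrand ^ (i + 1)) s ∈ Δ) :
    ∑ d ∈ Δ, G.colourSign d * c d * G.segment s n d =
      (if G.white s then 0 else c (G.exitEdge s)) -
        if G.white ((G.nextStrand ^ n) s) then 0 else c (G.exitEdge ((G.nextStrand ^ n) s)) := by
  rw [sum_mul_segment _ hΔ]
  simp only [pow_succ', Equiv.Perm.mul_apply, colourSign_mul_nextStrand hc]
  simp only [← Equiv.Perm.mul_apply, ← pow_succ']
  exact Finset.sum_range_sub' (fun i => if G.white ((G.nextStrand ^ i) s) then 0
    else c (G.exitEdge ((G.nextStrand ^ i) s))) n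

end Segment

theorem boundary_indicator_sameTrack (s : D) :
    G.boundary ({u | G.SameTrack s u}.indicator 1) = 0 := by
  classical
  ext d
  have hrev : G.SameTrack s (G.rev d) ↔ G.SameTrack s d :=
    ⟨fun h => h.trans (sameTrack_rev d).symm, fun h => h.trans (sameTrack_rev d)⟩
  have hface : G.SameTrack s (G.faceNext (G.rev d)) ↔ G.SameTrack s (G.faceNext d) := by
    have h := sameTrack_rot_symm_faceNext (G := G) d
    rw [PlaneMap.faceNext_rev]
    exact ⟨fun h' => h'.trans h, fun h' => h'.trans h.symm⟩
  simp only [boundary_apply, Set.indicator_apply, Set.mem_ofPred_eq, hrev, hface, Pi.one_apply,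
    Pi.zero_apply]
  ring

theorem forall_of_sideOf {P : G.QuadVertex → Prop}
    (hP : ∀ s, P (G.sideOf true s) ↔ P (G.sideOf false s)) {q : G.QuadVertex} (hq : P q)
    (r : G.QuadVertex) : P r := by
  classical
  have hjump : G.jump ({q | P q}.indicator 1) = 0 := by
    ext s
    simp [jump_apply_eq_sideOf, Set.indicator_apply, hP]
  have h := eq_of_jump_eq_zero hjump q r
  by_contra hr
  simp [hq, hr] at h

theorem apply_sideOf_pow_of_jump_eq_zero (hadj : ∀ d, ¬G.SameTrack (G.rot.symm d) d) {s : D}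
    {H : G.QuadVertex → ℤ} (hH : ∀ w, ¬G.SameTrack s w → G.jump H w = 0) (b : Bool) (i : ℕ) :
    H (G.sideOf b ((G.nextStrand ^ i) s)) = H (G.sideOf b s) := by
  induction i with
  | zero => rfl
  | succ i ih =>
    obtain ⟨w, hw⟩ := exists_crosses (G := G) ((G.nextStrand ^ i) s)
    have hs : ¬G.SameTrack s w := fun h => hw.not_sameTrack hadj ((SameTrack.pow s i).symm.trans h)
    rw [← ih, pow_succ', Equiv.Perm.mul_apply]
    exact hw.apply_sideOf_nextStrand (hH w hs)
      (hH _ (mt Equiv.Perm.sameCycle_apply_right.1 hs)) b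

variable (G) in
/-- Two distinct train-tracks meet where the strands `s` and `t` end, and meet again `m` strands
later on the first one and `n` strands later on the second one, the latter being disjoint from the
whole first train-track in between. -/
structure IsBigon (s t : D) (m n : ℕ) : Prop where
  crosses : G.Crosses s t
  crosses_pow : G.Crosses ((G.nextStrand ^ m) s) ((G.nextStrand ^ n) t)
  pos_left : 0 < m
  pos_right : 0 < n
  disjoint : ∀ i, 0 < i → i < n → ∀ w, G.SameTrack s w →
    G.exitEdge w ≠ G.exitEdge ((G.nextStrand ^ i) t)

theorem HasParallelBigon.exists_isBigon (h : G.HasParallelBigon) :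
    ∃ s t m n, G.IsBigon s t m n := by
  classical
  have hex : ∃ n s t m, ¬G.SameTrack s t ∧ G.exitEdge s = G.exitEdge t ∧ 0 < m ∧ 0 < n ∧
      G.exitEdge ((G.nextStrand ^ m) s) = G.exitEdge ((G.nextStrand ^ n) t) := by
    obtain ⟨s, t, htrack, hexit, m, n, hm, hn, hexit', -⟩ := h
    exact ⟨n, s, t, m, htrack, hexit, hm, hn, hexit'⟩
  obtain ⟨s, t, m, htrack, hexit, hm, hn, hexit'⟩ := Nat.find_spec hex
  have hne {u u' : D} (hu : G.SameTrack s u) (hu' : G.SameTrack t u') : u ≠ u' := by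
    rintro rfl
    exact htrack (hu.trans hu'.symm)
  refine ⟨s, t, m, Nat.find hex, ⟨hne (.refl _ _) (.refl _ _), hexit⟩,
    ⟨hne (.pow s m) (.pow t _), hexit'⟩, hm, hn, ?_⟩
  rintro i hi hin w ⟨k, rfl⟩ hw
  rcases lt_or_ge k m with hk | hk
  · refine Nat.find_min hex (m := Nat.find hex - i) (by omega)
      ⟨(G.nextStrand ^ k) s, (G.nextStrand ^ i) t, (m - k).toNat, fun h => ?_, hw, by omega,
        by omega, ?_⟩
    · exact hne ⟨k, rfl⟩ ((SameTrack.pow t i).trans h.symm) rfl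
    · rw [← zpow_natCast, Int.toNat_of_nonneg (by omega), ← Equiv.Perm.mul_apply, ← zpow_add,
        ← Equiv.Perm.mul_apply, ← pow_add, Nat.sub_add_cancel hin.le, sub_add_cancel, zpow_natCast]
      exact hexit'
  · lift k to ℕ using by omega
    exact Nat.find_min hex hin ⟨s, t, k, htrack, hexit, by omega, hi, by simpa using hw⟩

variable (G) in
/-- The sum of the functions of an edge potential at both ends of a bigon: it is the indicator
function of the faces of the graph of train-tracks inside the bigon. -/
def bigonFunction (h : D → G.QuadVertex → ℤ) (t : D) (n : ℕ) : G.QuadVertex → ℤ :=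
  h (G.exitEdge t) + h (G.exitEdge ((G.nextStrand ^ n) t))

namespace IsBigon

variable {s t : D} {m n : ℕ}

theorem apply_sideOf_pow (hB : G.IsBigon s t m n) (hadj : ∀ d, ¬G.SameTrack (G.rot.symm d) d)
    {H : G.QuadVertex → ℤ}
    (hH : ∀ w, ¬G.SameTrack s w → ¬G.SameTrack t w → G.jump H w = 0) (b : Bool) {i : ℕ}
    (hi : 0 < i) (hin : i ≤ n) :
    H (G.sideOf b ((G.nextStrand ^ i) t)) = H (G.sideOf b (G.nextStrand t)) := by
  induction i, hi using Nat.le_induction with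
  | base => rw [pow_one]
  | succ i hi ih =>
    obtain ⟨w, hw⟩ := exists_crosses (G := G) ((G.nextStrand ^ i) t)
    have hs : ¬G.SameTrack s w := fun h => hB.disjoint i hi hin w h hw.2.symm
    have ht : ¬G.SameTrack t w := fun h => hw.not_sameTrack hadj ((SameTrack.pow t i).symm.trans h)
    rw [← ih (by omega), pow_succ', Equiv.Perm.mul_apply]
    exact hw.apply_sideOf_nextStrand (hH w hs ht)
      (hH _ (mt Equiv.Perm.sameCycle_apply_right.1 hs) (mt Equiv.Perm.sameCycle_apply_right.1 ht)) b

theorem white_pow (hB : G.IsBigon s t m n) (hadj : ∀ d, ¬G.SameTrack (G.rot.symm d) d) :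
    G.white ((G.nextStrand ^ n) t) = !G.white t := by
  classical
  obtain ⟨H, hH, -⟩ := exists_jump_eq (boundary_indicator_sameTrack (G := G) s) (G.sideOf true s)
  have hjump (u : D) : G.jump H u = if G.SameTrack s u then 1 else 0 := by
    rw [hH, Set.indicator_apply]
    rfl
  have hzero (u : D) (hu : ¬G.SameTrack s u) : G.jump H u = 0 := by rw [hjump, if_neg hu]
  have hright (b b' : Bool) :
      H (G.sideOf b ((G.nextStrand ^ n) t)) = H (G.sideOf b' (G.nextStrand t)) := by
    have hsides := hzero (G.nextStrand t) fun h => hB.crosses.not_sameTrack hadj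
      (Equiv.Perm.sameCycle_apply_right.1 h)
    rw [jump_apply_eq_sideOf, sub_eq_zero] at hsides
    rw [hB.apply_sideOf_pow hadj (fun w hw _ => hzero w hw) b hB.pos_right le_rfl]
    cases b <;> cases b' <;> simp only [hsides]
  have hleft := apply_sideOf_pow_of_jump_eq_zero hadj hzero
  have hends : H (G.sideOf (G.white s) s) = H (G.sideOf (!G.white ((G.nextStrand ^ m) s)) s) := by
    rw [← hleft _ 1, pow_one, hB.crosses.sideOf_nextStrand, ← hleft _ m, hB.crosses_pow.sideOf_not,
      hright]
  have hne := hjump s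
  rw [jump_apply_eq_sideOf, if_pos (.refl _ _)] at hne
  rw [hB.crosses_pow.white_right, hB.crosses.white_right]
  cases hs : G.white s <;> cases hs' : G.white ((G.nextStrand ^ m) s) <;> simp_all

section BigonFunction

variable {h : D → G.QuadVertex → ℤ}

theorem jump_bigonFunction (hB : G.IsBigon s t m n) (hh : G.IsEdgePotential h)
    (hloop : G.NoTrackLoops) (hadj : ∀ d, ¬G.SameTrack (G.rot.symm d) d) :
    G.jump (G.bigonFunction h t n) = G.colourSign t • (G.segment t n - G.segment s m) := by
  have hsign : G.colourSign ((G.nextStrand ^ n) t) = -G.colourSign t := by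
    cases ht : G.white t <;> simp [colourSign, hB.white_pow hadj, ht]
  rw [bigonFunction, map_add, hh.jump_exitEdge hB.crosses.symm,
    hh.jump_exitEdge hB.crosses_pow.symm, hsign, ← hloop.ray_sub_ray_pow, ← hloop.ray_sub_ray_pow]
  module

theorem bigonFunction_sideOf_right (hB : G.IsBigon s t m n) (hh : G.IsEdgePotential h)
    (hloop : G.NoTrackLoops) (hadj : ∀ d, ¬G.SameTrack (G.rot.symm d) d) (b : Bool) {i : ℕ}
    (hi : 0 < i) (hin : i ≤ n) :
    G.bigonFunction h t n (G.sideOf b ((G.nextStrand ^ i) t)) = if G.white t = b then 1 else 0 := by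
  have hray {p w : D} (hp : G.SameTrack p w → False) : G.ray (G.nextStrand p) w = 0 :=
    ray_eq_zero_of_not_sameTrack (mt Equiv.Perm.sameCycle_apply_left.1 hp)
  have hstart := hB.apply_sideOf_pow (H := h (G.exitEdge t)) hadj (fun w hs ht => by
    simp [hh.jump_exitEdge hB.crosses.symm, hray hs, hray ht]) b hi hin
  have hend {j : ℕ} := hB.apply_sideOf_pow (i := j)
    (H := h (G.exitEdge ((G.nextStrand ^ n) t))) hadj (fun w hs ht => by
      simp [hh.jump_exitEdge hB.crosses_pow.symm, hray fun h' => hs ((SameTrack.pow s m).trans h'),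
        hray fun h' => ht ((SameTrack.pow t n).trans h')]) b
  rw [bigonFunction, Pi.add_apply, hstart, hh.sideOf_nextStrand hadj, hend hi hin,
    ← hend hB.pos_right le_rfl, hh.sideOf_eq_zero hloop hadj, add_zero]

theorem pow_ne_of_crosses (hB : G.IsBigon s t m n) (hloop : G.NoTrackLoops)
    (hadj : ∀ d, ¬G.SameTrack (G.rot.symm d) d) {i j : ℕ} (hi : 0 < i) (him : i ≠ m) (hj : j ≤ n)
    {w : D} (hw : G.Crosses ((G.nextStrand ^ i) s) w) : (G.nextStrand ^ j) t ≠ w := by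
  rintro rfl
  rcases j.eq_zero_or_pos with rfl | hj0
  · exact hi.ne' (hloop.eq_of_exitEdge_pow_eq hadj (hw.2.trans hB.crosses.2.symm))
  rcases hj.eq_or_lt with rfl | hjn
  · exact him (hloop.eq_of_exitEdge_pow_eq hadj (hw.2.trans hB.crosses_pow.2.symm))
  · exact hB.disjoint j hj0 hjn _ (.pow s i) hw.2

theorem bigonFunction_sideOf_left_succ (hB : G.IsBigon s t m n) (hh : G.IsEdgePotential h)
    (hloop : G.NoTrackLoops) (hadj : ∀ d, ¬G.SameTrack (G.rot.symm d) d) (b : Bool) {i : ℕ}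
    (hi : 0 < i) (him : i ≠ m) :
    G.bigonFunction h t n (G.sideOf b ((G.nextStrand ^ (i + 1)) s)) =
      G.bigonFunction h t n (G.sideOf b ((G.nextStrand ^ i) s)) := by
  obtain ⟨w, hw⟩ := exists_crosses (G := G) ((G.nextStrand ^ i) s)
  have hs : ¬G.SameTrack s w := fun h' => hw.not_sameTrack hadj ((SameTrack.pow s i).symm.trans h')
  have ht {j : ℕ} (hj : j ≤ n) := hB.pow_ne_of_crosses hloop hadj hi him hj hw
  have hjump {u : D} (hu : ¬G.SameTrack s u) (hu' : ∀ j < n, (G.nextStrand ^ (j + 1)) t ≠ u) :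
      G.jump (G.bigonFunction h t n) u = 0 := by
    rw [hB.jump_bigonFunction hh hloop hadj, Pi.smul_apply, Pi.sub_apply, segment_eq_zero hu',
      segment_eq_zero_of_not_sameTrack hu, sub_self, smul_zero]
  rw [pow_succ', Equiv.Perm.mul_apply]
  refine hw.apply_sideOf_nextStrand (hjump hs fun j hj => ht hj)
    (hjump (mt Equiv.Perm.sameCycle_apply_right.1 hs) fun j hj h' => ht hj.le ?_) b
  rwa [pow_succ', Equiv.Perm.mul_apply, G.nextStrand.injective.eq_iff] at h'

theorem bigonFunction_sideOf_left (hB : G.IsBigon s t m n) (hh : G.IsEdgePotential h)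
    (hloop : G.NoTrackLoops) (hadj : ∀ d, ¬G.SameTrack (G.rot.symm d) d) (b : Bool) {i : ℕ}
    (hi : 0 < i) (him : i ≤ m) :
    G.bigonFunction h t n (G.sideOf b ((G.nextStrand ^ i) s)) = if G.white s = b then 1 else 0 := by
  induction i, hi using Nat.le_induction with
  | base =>
    have hwhite := hB.crosses.white_right
    have hinner := hB.bigonFunction_sideOf_right hh hloop hadj (!G.white s) one_pos hB.pos_right
    have hjump := congrFun (hB.jump_bigonFunction hh hloop hadj) (G.nextStrand s)
    have ht : G.segment t n (G.nextStrand s) = 0 := segment_eq_zero_of_not_sameTrack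
      fun ht => hB.crosses.symm.not_sameTrack hadj (ht.trans (SameTrack.nextStrand s).symm)
    rw [pow_one, ← hB.crosses.sideOf_nextStrand] at hinner
    rw [jump_apply_eq_sideOf, Pi.smul_apply, Pi.sub_apply, ht,
      hloop.segment_nextStrand s hB.pos_left] at hjump
    rw [pow_one]
    cases hs : G.white s <;> cases b <;> simp_all [colourSign]
  | succ i hi ih =>
    rw [hB.bigonFunction_sideOf_left_succ hh hloop hadj b hi (by omega), ih (by omega)]

theorem bigonFunction_sideOf_outer (hB : G.IsBigon s t m n) (hh : G.IsEdgePotential h)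
    (hloop : G.NoTrackLoops) (hadj : ∀ d, ¬G.SameTrack (G.rot.symm d) d) {i : ℕ} (hi : m < i) :
    G.bigonFunction h t n (G.sideOf (!G.white t) ((G.nextStrand ^ i) s)) = 0 := by
  induction i, hi using Nat.le_induction with
  | base =>
    have houter := hB.crosses_pow.symm.sideOf_self
    rw [hB.white_pow hadj] at houter
    rw [pow_succ', Equiv.Perm.mul_apply, ← houter,
      hB.bigonFunction_sideOf_right hh hloop hadj _ hB.pos_right le_rfl]
    simp
  | succ i hi ih =>
    rw [hB.bigonFunction_sideOf_left_succ hh hloop hadj _ (by omega) (by omega), ih]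

theorem bigonFunction_eq_zero_or_one (hB : G.IsBigon s t m n) (hh : G.IsEdgePotential h)
    (hloop : G.NoTrackLoops) (hadj : ∀ d, ¬G.SameTrack (G.rot.symm d) d) (q : G.QuadVertex) :
    G.bigonFunction h t n q = 0 ∨ G.bigonFunction h t n q = 1 := by
  have hright {b : Bool} {i : ℕ} (hi : 0 < i) (hin : i ≤ n) :
      G.bigonFunction h t n (G.sideOf b ((G.nextStrand ^ i) t)) = 0 ∨
        G.bigonFunction h t n (G.sideOf b ((G.nextStrand ^ i) t)) = 1 := by
    rw [hB.bigonFunction_sideOf_right hh hloop hadj b hi hin]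
    exact (ite_eq_or_eq _ _ _).symm
  have hleft {b : Bool} {i : ℕ} (hi : 0 < i) (him : i ≤ m) :
      G.bigonFunction h t n (G.sideOf b ((G.nextStrand ^ i) s)) = 0 ∨
        G.bigonFunction h t n (G.sideOf b ((G.nextStrand ^ i) s)) = 1 := by
    rw [hB.bigonFunction_sideOf_left hh hloop hadj b hi him]
    exact (ite_eq_or_eq _ _ _).symm
  refine forall_of_sideOf (P := fun q => G.bigonFunction h t n q = 0 ∨ G.bigonFunction h t n q = 1)
    (fun u => ?_) (hright (b := true) hB.pos_right le_rfl) q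
  by_cases ht : ∃ i < n, (G.nextStrand ^ (i + 1)) t = u
  · obtain ⟨i, hi, rfl⟩ := ht
    exact iff_of_true (hright i.succ_pos hi) (hright i.succ_pos hi)
  by_cases hs : ∃ i < m, (G.nextStrand ^ (i + 1)) s = u
  · obtain ⟨i, hi, rfl⟩ := hs
    exact iff_of_true (hleft i.succ_pos hi) (hleft i.succ_pos hi)
  have hjump := congrFun (hB.jump_bigonFunction hh hloop hadj) u
  rw [jump_apply_eq_sideOf, Pi.smul_apply, Pi.sub_apply,
    segment_eq_zero fun i hi h => ht ⟨i, hi, h⟩, segment_eq_zero fun i hi h => hs ⟨i, hi, h⟩,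
    sub_self, smul_zero, sub_eq_zero] at hjump
  rw [hjump]

end BigonFunction

end IsBigon

end BipartitePlaneGraph

theorem sum_mul_comp_nonneg {D Q R : Type*} [Semiring R] [PartialOrder R] [IsOrderedRing R]
    {ρ : D → Q} {φ : D → R} {w : Q → R} (hw : ∀ q, 0 ≤ w q) {fiber : D → Finset D}
    (hfiber : ∀ {d e}, e ∈ fiber d ↔ ρ e = ρ d) (hφ : ∀ d, 0 ≤ ∑ e ∈ fiber d, φ e) {Δ : Finset D}
    (hΔ : ∀ d, w (ρ d) ≠ 0 → d ∈ Δ) : 0 ≤ ∑ d ∈ Δ, φ d * w (ρ d) := by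
  classical
  rw [← Finset.sum_fiberwise_of_maps_to fun d hd => Finset.mem_image_of_mem ρ hd]
  refine Finset.sum_nonneg fun q hq => ?_
  obtain ⟨d, -, rfl⟩ := Finset.mem_image.1 hq
  rw [Finset.sum_congr rfl fun e he => by rw [(Finset.mem_filter.1 he).2], ← Finset.sum_mul]
  by_cases hd : w (ρ d) = 0
  · rw [hd, mul_zero]
  · have hfilter : {e ∈ Δ | ρ e = ρ d} = fiber d := by
      ext e
      rw [Finset.mem_filter, hfiber]
      exact and_iff_right_of_imp fun he => hΔ e (he ▸ hd)
    exact mul_nonneg (hfilter ▸ hφ d) (hw _)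

namespace BipartitePlaneGraph

open Filter

variable {D : Type*} {G : BipartitePlaneGraph D}

/-- A discrete Gauss–Bonnet inequality, the sums of `c` being the curvatures. -/
theorem sum_colourSign_mul_jump_nonpos {c : D → ℤ}
    (hvertex : ∀ d, ∑ e ∈ G.planar.vertexDarts d, c e ≤ 0)
    (hface : ∀ d, 0 ≤ ∑ e ∈ G.planar.faceDarts d, c e) {F : G.QuadVertex → ℤ} (hF : ∀ q, 0 ≤ F q)
    {Δ : Finset D} (hΔ : ∀ b d, F (G.sideOf b d) ≠ 0 → d ∈ Δ) :
    ∑ d ∈ Δ, G.colourSign d * c d * G.jump F d ≤ 0 := by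
  have hvertices : 0 ≤ ∑ d ∈ Δ, -c d * F (.inl (G.vertexOf d)) :=
    sum_mul_comp_nonneg (w := fun v => F (.inl v)) (fun _ => hF _) G.planar.mem_vertexDarts
      (fun d => by rw [Finset.sum_neg_distrib]; exact neg_nonneg.2 (hvertex d))
      fun d hd => hΔ (G.white d) d (by rwa [sideOf, if_pos rfl])
  have hfaces : 0 ≤ ∑ d ∈ Δ, c d * F (.inr (G.faceOf d)) :=
    sum_mul_comp_nonneg (w := fun f => F (.inr f)) (fun _ => hF _) G.planar.mem_faceDarts hface
      fun d hd => hΔ (!G.white d) d (by simpa [sideOf] using hd)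
  have hsum : ∑ d ∈ Δ, G.colourSign d * c d * G.jump F d =
      -(∑ d ∈ Δ, -c d * F (.inl (G.vertexOf d)) + ∑ d ∈ Δ, c d * F (.inr (G.faceOf d))) := by
    rw [← Finset.sum_add_distrib, ← Finset.sum_neg_distrib]
    refine Finset.sum_congr rfl fun d _ => ?_
    rw [jump_apply]
    linear_combination
      c d * (F (.inl (G.vertexOf d)) - F (.inr (G.faceOf d))) * G.colourSign_mul_self d
  rw [hsum]
  exact neg_nonpos.2 (add_nonneg hvertices hfaces)

namespace IsBigon

variable {s t : D} {m n : ℕ} {h : D → G.QuadVertex → ℤ} {c : D → ℤ}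

theorem bigonFunction_eventuallyEq_zero (hB : G.IsBigon s t m n) (hh : G.IsEdgePotential h)
    (hloop : G.NoTrackLoops) (hadj : ∀ d, ¬G.SameTrack (G.rot.symm d) d) :
    G.bigonFunction h t n =ᶠ[cofinite] 0 := by
  have hsegment (p : D) (k : ℕ) : G.segment p k =ᶠ[cofinite] 0 := by
    rw [← hloop.ray_sub_ray_pow]
    have htrack : G.SameTrack (G.nextStrand p) (G.nextStrand ((G.nextStrand ^ k) p)) :=
      (SameTrack.nextStrand p).symm.trans ((SameTrack.pow p k).trans (SameTrack.nextStrand _))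
    exact (hloop.ray_eventuallyEq htrack).mono fun _ => sub_eq_zero.2
  have hjump : G.jump (G.bigonFunction h t n) =ᶠ[cofinite] 0 := by
    rw [hB.jump_bigonFunction hh hloop hadj]
    filter_upwards [hsegment t n, hsegment s m] with u ht hs
    simp [ht, hs]
  obtain ⟨k, hk⟩ := exists_eventually_eq_const hjump
  obtain ⟨i, hi, hmi⟩ := ((((tendsto_sideOf _).comp (hloop.tendsto_pow s)).eventually hk).and
    (eventually_gt_atTop m)).exists
  rw [Function.comp_apply, hB.bigonFunction_sideOf_outer hh hloop hadj hmi] at hi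
  exact hk.mono fun q hq => hq.trans hi.symm

theorem level_add_level (hB : G.IsBigon s t m n) (hh : G.IsEdgePotential h)
    (hloop : G.NoTrackLoops) (hadj : ∀ d, ¬G.SameTrack (G.rot.symm d) d)
    (hc : ∀ d, HasLevel (h d) (c d)) :
    c (G.exitEdge t) + c (G.exitEdge ((G.nextStrand ^ n) t)) = -1 := by
  have hlevel := (hc (G.exitEdge ((G.nextStrand ^ n) t))).unique <|
    (hc (G.exitEdge t)).of_add_eventually_eq (c := 0)
      (hB.bigonFunction_eventuallyEq_zero hh hloop hadj)
  omega

theorem sum_colourSign_mul_jump (hB : G.IsBigon s t m n) (hh : G.IsEdgePotential h)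
    (hloop : G.NoTrackLoops) (hadj : ∀ d, ¬G.SameTrack (G.rot.symm d) d)
    (hc : ∀ d, c (G.rev d) = c d) {Δ : Finset D}
    (hΔ : ∀ b d, G.bigonFunction h t n (G.sideOf b d) ≠ 0 → d ∈ Δ) :
    ∑ d ∈ Δ, G.colourSign d * c d * G.jump (G.bigonFunction h t n) d =
      -(c (G.exitEdge t) + c (G.exitEdge ((G.nextStrand ^ n) t))) := by
  have ht (i : ℕ) (hi : i < n) : (G.nextStrand ^ (i + 1)) t ∈ Δ := hΔ (G.white t) _ <| by
    rw [hB.bigonFunction_sideOf_right hh hloop hadj _ i.succ_pos hi, if_pos rfl]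
    exact one_ne_zero
  have hs (i : ℕ) (hi : i < m) : (G.nextStrand ^ (i + 1)) s ∈ Δ := hΔ (G.white s) _ <| by
    rw [hB.bigonFunction_sideOf_left hh hloop hadj _ i.succ_pos hi, if_pos rfl]
    exact one_ne_zero
  have hsum : ∑ d ∈ Δ, G.colourSign d * c d * G.jump (G.bigonFunction h t n) d =
      G.colourSign t * (∑ d ∈ Δ, G.colourSign d * c d * G.segment t n d -
        ∑ d ∈ Δ, G.colourSign d * c d * G.segment s m d) := by
    rw [hB.jump_bigonFunction hh hloop hadj, ← Finset.sum_sub_distrib, Finset.mul_sum]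
    refine Finset.sum_congr rfl fun d _ => ?_
    rw [Pi.smul_apply, Pi.sub_apply, smul_eq_mul]
    ring
  rw [hsum, sum_colourSign_mul_segment hc ht, sum_colourSign_mul_segment hc hs, colourSign,
    hB.crosses.2, hB.crosses_pow.2, hB.crosses.symm.white_right,
    hB.crosses_pow.symm.white_right, hB.white_pow hadj]
  cases G.white t
  · simp
  · simp
    ring

end IsBigon

theorem not_hasParallelBigon (hloop : G.NoTrackLoops)
    (hadj : ∀ d, ¬G.SameTrack (G.rot.symm d) d)
    (horder : ∀ d, G.rot (G.rot d) ≠ d → G.GlobalOrder (G.rot.symm d) d (G.rot d))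
    (hface : ∀ d, ∃ e, G.SameFace d e ∧ G.rot (G.rot e) ≠ e) : ¬G.HasParallelBigon := by
  intro hbigon
  obtain ⟨s, t, m, n, hB⟩ := hbigon.exists_isBigon
  obtain ⟨h, hh⟩ := hloop.exists_isEdgePotential
  choose c hc using hh.exists_hasLevel hloop hadj horder hface
  have hfinite : {d | ∃ b, G.bigonFunction h t n (G.sideOf b d) ≠ 0}.Finite := by
    have hzero := hB.bigonFunction_eventuallyEq_zero hh hloop hadj
    have hsides : ∀ᶠ d in cofinite, ∀ b, G.bigonFunction h t n (G.sideOf b d) = 0 :=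
      eventually_all.2 fun b => (tendsto_sideOf b).eventually hzero
    simpa only [eventually_cofinite, not_forall] using hsides
  have hΔ (b : Bool) (d : D) (hd : G.bigonFunction h t n (G.sideOf b d) ≠ 0) :
      d ∈ hfinite.toFinset := hfinite.mem_toFinset.2 ⟨b, hd⟩
  have hnonneg (q : G.QuadVertex) : 0 ≤ G.bigonFunction h t n q := by
    rcases hB.bigonFunction_eq_zero_or_one hh hloop hadj q with hq | hq <;> simp [hq]
  have hle := sum_colourSign_mul_jump_nonpos (hh.sum_level_vertexDarts_nonpos hloop hadj hc)
    (hh.sum_level_faceDarts_nonneg hloop hadj horder hface hc) hnonneg hΔ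
  rw [hB.sum_colourSign_mul_jump hh hloop hadj (hh.level_rev hc) hΔ,
    hB.level_add_level hh hloop hadj hc] at hle
  exact absurd hle (by norm_num)

theorem orbitOrder_rot {d : D} (hdeg : G.rot d ≠ d) (hd : G.rot (G.rot d) ≠ d) :
    PlaneMap.OrbitOrder G.rot (G.rot.symm d) d (G.rot d) := by
  refine ⟨1, 2, one_pos, one_lt_two, ?_, by simp, by simp [pow_two]⟩
  have hpos : 0 < Function.minimalPeriod G.rot (G.rot.symm d) :=
    minimalPeriod_pos_of_finite_sameCycle (G.planar.vertex_finite _)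
  have hperiod := pow_minimalPeriod_apply G.rot (G.rot.symm d)
  by_contra hlt
  obtain hp | hp : Function.minimalPeriod G.rot (G.rot.symm d) = 1 ∨
      Function.minimalPeriod G.rot (G.rot.symm d) = 2 := by omega
  · rw [hp, pow_one, Equiv.apply_symm_apply, Equiv.eq_symm_apply] at hperiod
    exact hdeg hperiod
  · rw [hp, pow_two, Equiv.Perm.mul_apply, Equiv.apply_symm_apply, Equiv.eq_symm_apply] at hperiod
    exact hd hperiod

namespace VertexCondition

theorem not_sameTrack_rot_symm (hvertex : G.VertexCondition) (hdeg : G.NoDegreeOne) (d : D) :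
    ¬G.SameTrack (G.rot.symm d) d :=
  (hvertex d).1 _ (PlaneMap.vertexOf_eq_iff.1 (PlaneMap.vertexOf_rot_symm d).symm) d (.refl _ _)
    fun h => hdeg d (G.rot.symm_apply_eq.1 h).symm

theorem globalOrder_rot (hvertex : G.VertexCondition) (hdeg : G.NoDegreeOne) (d : D)
    (hd : G.rot (G.rot d) ≠ d) : G.GlobalOrder (G.rot.symm d) d (G.rot d) := by
  have hprev : G.rot.symm d ∈ G.vertexStrands d :=
    PlaneMap.vertexOf_eq_iff.1 (PlaneMap.vertexOf_rot_symm d).symm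
  have hself : d ∈ G.vertexStrands d := Equiv.Perm.SameCycle.refl _ _
  have hnext : G.rot d ∈ G.vertexStrands d :=
    PlaneMap.vertexOf_eq_iff.1 (PlaneMap.vertexOf_rot d).symm
  have hdistinct := (hvertex d).1
  refine ((hvertex d).2 _ hprev _ hself _ hnext ?_ ?_ ?_).2 (orbitOrder_rot (hdeg d) hd)
  · exact hvertex.not_sameTrack_rot_symm hdeg d
  · exact hdistinct _ hself _ hnext (hdeg d).symm
  · exact hdistinct _ hprev _ hnext fun h => hd (G.rot.symm_apply_eq.1 h).symm

end VertexCondition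

theorem sameTrack_faceNext_faceNext {d : D} (hd : G.white d = true)
    (hrot : G.rot (G.rot (G.faceNext d)) = G.faceNext d) :
    G.SameTrack (G.faceNext (G.faceNext d)) d := by
  have hnext : G.nextStrand (G.faceNext (G.faceNext d)) = G.rev d := by
    rw [nextStrand_of_white (by simp [white_faceNext, hd]), PlaneMap.rot_faceNext,
      PlaneMap.faceNext_rev, Equiv.symm_apply_eq, ← PlaneMap.rot_faceNext, hrot]
  have h := SameTrack.nextStrand (G := G) (G.faceNext (G.faceNext d))
  rw [hnext] at h
  exact h.trans (sameTrack_rev d).symm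

/-- If all vertices of a face had degree two, then its strands turning around white vertices would
all belong to the same train-track. -/
theorem FaceCondition.exists_rot_rot_ne (hface : G.FaceCondition) (d : D) :
    ∃ e, G.SameFace d e ∧ G.rot (G.rot e) ≠ e := by
  by_contra! hrot
  obtain ⟨s, ⟨hs, hsw⟩, t, ⟨ht, htw⟩, hst, -⟩ := (hface d).2.1
  let whiteStrand (e : D) : D := if G.white e then e else G.faceNext e
  let InTrack (e : D) : Prop := G.SameFace d e → G.SameTrack s (whiteStrand e)
  have hinv (e : D) : InTrack (G.faceNext e) = InTrack e := by
    unfold InTrack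
    rw [PlaneMap.SameFace, Equiv.Perm.sameCycle_apply_right]
    refine propext (forall_congr' fun he => ?_)
    cases hw : G.white e
    · simp [whiteStrand, white_faceNext, hw]
    · have h := sameTrack_faceNext_faceNext hw (hrot _ (Equiv.Perm.sameCycle_apply_right.2 he))
      simp only [whiteStrand, white_faceNext, hw, Bool.not_true, Bool.false_eq_true, if_false,
        if_true]
      exact ⟨fun h' => h'.trans h, fun h' => h'.trans h.symm⟩
  have hs' : InTrack s := fun _ => by
    simp only [whiteStrand, hsw, if_true]
    exact .refl _ _
  have ht' : InTrack t := (apply_eq_of_sameCycle hinv (hs.symm.trans ht)).mp hs'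
  exact hst (by simpa only [whiteStrand, htw, if_true] using ht' ht)

end BipartitePlaneGraph

theorem corollary3p7_general {D : Type*} (G : BipartitePlaneGraph D) (hloop : G.NoTrackLoops)
    (hadj : ∀ d, ¬G.SameTrack (G.rot.symm d) d)
    (horder : ∀ d, G.rot (G.rot d) ≠ d → G.GlobalOrder (G.rot.symm d) d (G.rot d))
    (hface : ∀ d, ∃ e, G.SameFace d e ∧ G.rot (G.rot e) ≠ e) : G.IsMinimal :=
  ⟨BipartitePlaneGraph.not_hasSelfIntersection hadj,
    BipartitePlaneGraph.not_hasParallelBigon hloop hadj horder hface⟩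

theorem corollary3p7 {D : Type*} (G : BipartitePlaneGraph D)
    (hloop : G.NoTrackLoops) (hdeg : G.NoDegreeOne)
    (hvertex : G.VertexCondition) (hface : G.FaceCondition) :
    G.IsMinimal := by
  exact corollary3p7_general G hloop (hvertex.not_sameTrack_rot_symm hdeg)
    (hvertex.globalOrder_rot hdeg) hface.exists_rot_rot_ne
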